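/- **Notation.** Let $\mathbb{Q}(q^{1/4})$ be the field of rational functions in one variable $q^{1/4}$. Put $[k]=\dfrac{q^{k/2}-q^{-k/2}}{q^{1/2}-q^{-1/2}}$, $(q)_k=\prod_{l=1}^{k}(1-q^l)$ and $\binom{n}{k}_q=\dfrac{(q)_n}{(q)_k(q)_{n-k}}$ for $0\le k\le n$. Let $W_m$ be the $\mathbb{Q}(q^{1/4})$-vector space whose basis is the set of crossingless matchings of $m$ marked points on the boundary of a disk, by disjoint arcs inside the disk, up to isotopy fixing the boundary. The Kauffman bracket $\langle\,\cdot\,\rangle_2$ sends tangle diagrams in the disk with these $m$ end points to $W_m$. It is determined by two rules. A crossing whose overpassing strand has positive slope (runs from lower left to upper right) equals $q^{1/4}$ times its vertical smoothing $)($ plus $q^{-1/4}$ times its horizontal smoothing $\asymp$. A closed loop without crossings may be removed at the cost of the factor $-[2]$. A strand labelled $n$ stands for $n$ parallel strands. The clasps (Jones–Wenzl projectors) $P_n\in W_{n+n}$, regarded as webs on $n$ horizontal strands, are defined as follows. The projectors $P_0$ and $P_1$ are the trivial webs. For $n\ge 2$, with $P_{n-1}\otimes 1$ denoting $P_{n-1}$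 next to one further straight strand, and $U$ denoting the web in which the first $n-2$ strands are straight and the last two strands turn back on both sides, $$P_n=(P_{n-1}\otimes 1)+\frac{[n-1]}{[n]}\,(P_{n-1}\otimes 1)\,U\,(P_{n-1}\otimes 1).$$ **Proposition (full twist formula).** Let $n\ge 0$, and consider a disk with four groups of $n$ consecutive boundary points: lower left, upper left, lower right, upper right. Let $T_n\in W_{4n}$ be the bracket of the full twist of two $n$-strand bands running from left to right. That is, the two bands cross twice, and in both crossings the band going from upper left to lower right passes over the other one. For $0\le k\le n$, let $w_{n,k}\in W_{4n}$ be the crossingless web with - $k$ parallel arcs joining upper left to upper right, - $k$ parallel arcs joining lower left to lower right, - $n-k$ parallel arcs joining upper left to lower left, - $n-k$ parallel arcs joining upper right to lower right. For $w\in W_{4n}$ let $C(w)\in W_{4n}$ be the clasped web obtained by gluing a clasp $P_n$ to each of the four groups of end points of $w$, extended linearly in $w$ and in the clasps. Then $$C(T_n)=\sum_{k=0}^{n}(-1)^{n-k}\,q^{\frac{2k^2-n^2+k-n}{2}}\,\frac{(q)_n}{(q)_k}\binom{n}{k}_q\,C(w_{n,k}).$$ -/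

import Mathlib

noncomputable section

namespace A1Web

/-! The marked points of the disk `D_m` are numbered `0, …, m - 1` counterclockwise. In all comments
the disk is drawn as the upper half-plane (with a point at infinity), the marked points lying on the
real axis in increasing order from left to right. -/

/-- A basis web on `D_m`: a crossingless system of arcs in the disk joining the `m` marked points in
pairs, up to isotopy fixing the boundary. It is determined by the fixed-point-free involution
`mate`, and the involutions that occur are the noncrossing ones. -/
@[ext]
structure BasisWeb (m : ℕ) where
  mate : Fin m → Fin m
  mate_mate : ∀ x, mate (mate x) = x
  mate_ne : ∀ x, mate x ≠ x
  noncrossing : ∀ x y, ¬ (x < y ∧ y < mate x ∧ mate x < mate y)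

/-- The field `ℚ(q^{1/4})` of rational functions in one variable `q^{1/4}`. -/
abbrev K : Type := RatFunc ℚ

/-- The variable `q^{1/4}`. -/
def q4 : K := RatFunc.X

/-- The element `q`. -/
def q : K := q4 ^ 4

/-- `{k} = q^{k/2} - q^{-k/2}`. -/
def brace (k : ℤ) : K := q4 ^ (2 * k) - q4 ^ (-(2 * k))

/-- The quantum integer `[k] = {k} / {1}`. -/
def qInt (k : ℤ) : K := brace k / brace 1

/-- The `q`-Pochhammer symbol `(q)_k = (1 - q)(1 - q^2)⋯(1 - q^k)`. -/
def qPoch (k : ℕ) : K := ∏ l ∈ Finset.Icc 1 k, (1 - q ^ l)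

/-- The `q`-binomial coefficient `(q)_n / ((q)_k (q)_{n-k})`, which is `0` for `k > n`. -/
def qBinom (n k : ℕ) : K :=
  if k ≤ n then qPoch n / (qPoch k * qPoch (n - k)) else 0

/-- The `A_1` web space `W_m`: the vector space with basis the basis webs on `D_m`. -/
abbrev WebSpace (m : ℕ) : Type := BasisWeb m →₀ K

namespace BasisWeb

/-- The empty disk. -/
def empty : BasisWeb 0 where
  mate x := x
  mate_mate _ := rfl
  mate_ne x := x.elim0
  noncrossing x := x.elim0

/-- Order embedding of the old marked points when two new ones are created at places
`i` and `i + 1`. -/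
def ins {m : ℕ} (i : ℕ) (x : Fin m) : Fin (m + 2) :=
  if x.val < i then ⟨x.val, by omega⟩ else ⟨x.val + 2, by omega⟩

theorem val_ins {m : ℕ} (i : ℕ) (x : Fin m) :
    (ins i x).val = if x.val < i then x.val else x.val + 2 := by
  unfold ins; split_ifs <;> rfl

theorem eq_or_ins {m : ℕ} (i : ℕ) (hi : i ≤ m) (x : Fin (m + 2)) :
    x.val = i ∨ x.val = i + 1 ∨ ∃ y : Fin m, x = ins i y := by
  by_cases h0 : x.val = i
  · exact Or.inl h0
  by_cases h1 : x.val = i + 1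
  · exact Or.inr (Or.inl h1)
  refine Or.inr (Or.inr ?_)
  by_cases h : x.val < i
  · exact ⟨⟨x.val, by omega⟩, Fin.ext (by simp [val_ins, h])⟩
  · refine ⟨⟨x.val - 2, by omega⟩, Fin.ext ?_⟩
    rw [val_ins, if_neg (by simp only; omega)]
    simp only; omega

/-- The involution of `birth`. -/
def birthMate {m : ℕ} (i : ℕ) (hi : i ≤ m) (f : Fin m → Fin m) (x : Fin (m + 2)) : Fin (m + 2) :=
  if h : x.val < i then ins i (f ⟨x.val, by omega⟩)
  else if h0 : x.val = i then ⟨i + 1, by omega⟩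
  else if h1 : x.val = i + 1 then ⟨i, by omega⟩
  else ins i (f ⟨x.val - 2, by omega⟩)

theorem birthMate_ins {m : ℕ} (i : ℕ) (hi : i ≤ m) (f : Fin m → Fin m) (y : Fin m) :
    birthMate i hi f (ins i y) = ins i (f y) := by
  have hv := val_ins i y
  unfold birthMate
  split_ifs at hv with h
  · rw [dif_pos (by omega)]
    congr 2; exact Fin.ext hv
  · rw [dif_neg (by omega), dif_neg (by omega), dif_neg (by omega)]
    congr 2; apply Fin.ext; simp only; omega

theorem birthMate_left {m : ℕ} (i : ℕ) (hi : i ≤ m) (f : Fin m → Fin m) (x : Fin (m + 2))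
    (hx : x.val = i) : (birthMate i hi f x).val = i + 1 := by
  unfold birthMate
  rw [dif_neg (by omega), dif_pos hx]

theorem birthMate_right {m : ℕ} (i : ℕ) (hi : i ≤ m) (f : Fin m → Fin m) (x : Fin (m + 2))
    (hx : x.val = i + 1) : (birthMate i hi f x).val = i := by
  unfold birthMate
  rw [dif_neg (by omega), dif_neg (by omega), dif_pos hx]

/-- Create a new arc near the boundary, joining two new neighbouring marked points which get the
numbers `i` and `i + 1`. -/
def birth {m : ℕ} (i : ℕ) (hi : i ≤ m) (w : BasisWeb m) : BasisWeb (m + 2) where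
  mate := birthMate i hi w.mate
  mate_mate x := by
    rcases eq_or_ins i hi x with h | h | ⟨y, rfl⟩
    · apply Fin.ext
      rw [birthMate_right _ _ _ _ (birthMate_left _ _ _ _ h), h]
    · apply Fin.ext
      rw [birthMate_left _ _ _ _ (birthMate_right _ _ _ _ h), h]
    · rw [birthMate_ins, birthMate_ins, w.mate_mate]
  mate_ne x hx := by
    have hx' := congrArg Fin.val hx
    rcases eq_or_ins i hi x with h | h | ⟨y, rfl⟩
    · rw [birthMate_left _ _ _ _ h] at hx'; omega
    · rw [birthMate_right _ _ _ _ h] at hx'; omega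
    · rw [birthMate_ins, val_ins, val_ins] at hx'
      have := w.mate_ne y
      rw [Ne, Fin.ext_iff] at this
      split_ifs at hx' <;> omega
  noncrossing x y := by
    simp only [Fin.lt_def]
    rcases eq_or_ins i hi x with h | h | ⟨x, rfl⟩
    · rw [birthMate_left _ _ _ _ h]; omega
    · rw [birthMate_right _ _ _ _ h]; omega
    · rcases eq_or_ins i hi y with h | h | ⟨y, rfl⟩
      · rw [birthMate_left _ _ _ _ h, birthMate_ins, val_ins, val_ins]
        split_ifs <;> omega
      · rw [birthMate_right _ _ _ _ h]; omega
      · have := w.noncrossing x y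
        simp only [Fin.lt_def] at this
        rw [birthMate_ins, birthMate_ins, val_ins, val_ins, val_ins, val_ins]
        split_ifs <;> omega

/-- The involution of `turnback`. -/
def turnbackMate {m : ℕ} (i : ℕ) (hi : i + 1 < m) (f : Fin m → Fin m) (x : Fin m) : Fin m :=
  let a : Fin m := ⟨i, by omega⟩
  let b : Fin m := ⟨i + 1, hi⟩
  if x = a then b else if x = b then a
  else if f x = a then f b else if f x = b then f a else f x

/-- Arcs of a noncrossing matching do not separate each other. -/
theorem separate {m : ℕ} (w : BasisWeb m) (c u : Fin m) (h : u ≠ c) (h' : u ≠ w.mate c) :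
    ((c < u ↔ w.mate c < u) ↔ (c < w.mate u ↔ w.mate c < w.mate u)) := by
  obtain ⟨f, h1, h2, h3⟩ := w
  simp only at h' ⊢
  have e1 := h3 c u
  have e2 := h3 u c
  have e3 := h3 (f c) u
  have e4 := h3 u (f c)
  have e5 := h3 c (f u)
  have e6 := h3 (f u) c
  have e7 := h3 (f c) (f u)
  have e8 := h3 (f u) (f c)
  have n1 : f u ≠ c := fun e => h' (by rw [← e, h1])
  have n2 : f u ≠ f c := fun e => h (by rw [← h1 u, e, h1])
  simp only [h1, Fin.lt_def, ne_eq, Fin.ext_iff] at *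
  omega

theorem turnbackMate_noncrossing {m : ℕ} (i : ℕ) (hi : i + 1 < m) (w : BasisWeb m) (x y : Fin m) :
    ¬ (x < y ∧ y < turnbackMate i hi w.mate x ∧
      turnbackMate i hi w.mate x < turnbackMate i hi w.mate y) := by
  have h1 := w.mate_mate
  have sep := w.separate
  unfold turnbackMate
  simp only
  generalize ha : (⟨i, by omega⟩ : Fin m) = a
  generalize hb : (⟨i + 1, hi⟩ : Fin m) = b
  have hav : a.val = i := by rw [← ha]
  have hbv : b.val = i + 1 := by rw [← hb]
  have adj : ∀ u : Fin m, u ≠ a → u ≠ b → ((u < a ↔ u < b) ∧ (a < u ↔ b < u)) := by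
    intro u e1 e2
    simp only [ne_eq, Fin.ext_iff, Fin.lt_def] at *
    omega
  generalize hf : w.mate = f at *
  have hne : f x ≠ x := by rw [← hf]; exact w.mate_ne x
  have hnc : ¬ (x < y ∧ y < f x ∧ f x < f y) := by rw [← hf]; exact w.noncrossing x y
  have inj : ∀ u v, f u = f v → u = v := fun u v e => by rw [← h1 u, e, h1]
  rintro ⟨c1, c2, c3⟩
  by_cases xa : x = a
  · rw [if_pos xa] at c2
    simp only [Fin.lt_def, Fin.ext_iff] at *
    omega
  by_cases xb : x = b
  · rw [if_neg xa, if_pos xb] at c2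
    simp only [Fin.lt_def, Fin.ext_iff] at *
    omega
  rw [if_neg xa, if_neg xb] at c2 c3
  by_cases ya : y = a
  · rw [if_pos ya] at c3
    simp only [Fin.lt_def] at c1 c2 c3
    omega
  by_cases yb : y = b
  · rw [if_neg ya, if_pos yb] at c3
    simp only [Fin.lt_def] at c1 c2 c3
    omega
  rw [if_neg ya, if_neg yb] at c3
  have hxa : f x = a → x = f a := fun e => by rw [← e, h1]
  have hxb : f x = b → x = f b := fun e => by rw [← e, h1]
  have hya : f y = a → y = f a := fun e => by rw [← e, h1]
  have hyb : f y = b → y = f b := fun e => by rw [← e, h1]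
  have hab : f a = f b → a = b := inj a b
  have nab : a ≠ b := fun e => by rw [e] at hav; omega
  have sya := sep y a (Ne.symm ya)
  have syb := sep y b (Ne.symm yb)
  have sxa := sep x a (Ne.symm xa)
  have sxb := sep x b (Ne.symm xb)
  have ax := adj x xa xb
  have ay := adj y ya yb
  have afx := adj (f x)
  have afy := adj (f y)
  clear sep adj inj
  split_ifs at c2 c3 with k1 k2 k3 k4 k5
  all_goals simp only [Fin.lt_def, Fin.ext_iff, ne_eq] at *
  all_goals omega

/-- Join the ends number `i` and `i + 1` of a basis web by an arc, and then create a new arc with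
ends `i` and `i + 1`; a closed loop, which arises if `i` was joined to `i + 1`, is dropped. -/
def turnback {m : ℕ} (i : ℕ) (hi : i + 1 < m) (w : BasisWeb m) : BasisWeb m where
  mate := turnbackMate i hi w.mate
  mate_mate x := by
    have h1 := w.mate_mate
    have h2 := w.mate_ne
    have h3 : (⟨i, by omega⟩ : Fin m) ≠ ⟨i + 1, hi⟩ := by simp
    unfold turnbackMate
    grind
  mate_ne x := by
    have h1 := w.mate_mate
    have h2 := w.mate_ne
    have h3 : (⟨i, by omega⟩ : Fin m) ≠ ⟨i + 1, hi⟩ := by simp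
    unfold turnbackMate
    grind
  noncrossing x y := turnbackMate_noncrossing i hi w x y

/-- If `i` and `i + 1` are joined to each other, every other marked point is joined to one different
from these two. -/
theorem exists_ins_of_mate {m : ℕ} (i : ℕ) (hi : i ≤ m) (w : BasisWeb (m + 2))
    (hw : (w.mate ⟨i, by omega⟩).val = i + 1) (x : Fin m) :
    ∃ y : Fin m, w.mate (ins i x) = ins i y := by
  have hv := val_ins i x
  rcases eq_or_ins i hi (w.mate (ins i x)) with h | h | h
  · have h1 : w.mate (ins i x) = ⟨i, by omega⟩ := Fin.ext h
    have h2 := w.mate_mate (ins i x)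
    rw [h1] at h2
    rw [h2] at hw
    split_ifs at hv <;> omega
  · have h1 : w.mate (ins i x) = w.mate ⟨i, by omega⟩ := Fin.ext (h.trans hw.symm)
    have h2 := congrArg w.mate h1
    rw [w.mate_mate, w.mate_mate] at h2
    have h3 := congrArg Fin.val h2
    simp only at h3
    split_ifs at hv <;> omega
  · exact h

theorem ins_injective {m : ℕ} (i : ℕ) : Function.Injective (ins (m := m) i) := by
  intro x y h
  have h' := congrArg Fin.val h
  rw [val_ins, val_ins] at h'
  apply Fin.ext
  split_ifs at h' <;> omega

/-- Remove the arc joining the neighbouring marked points `i` and `i + 1`, together with these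
points; the other marked points are renumbered in order. -/
def removeArc {m : ℕ} (i : ℕ) (hi : i ≤ m) (w : BasisWeb (m + 2))
    (hw : (w.mate ⟨i, by omega⟩).val = i + 1) : BasisWeb m where
  mate x := (exists_ins_of_mate i hi w hw x).choose
  mate_mate x := by
    have h1 := (exists_ins_of_mate i hi w hw x).choose_spec
    have h2 := (exists_ins_of_mate i hi w hw
      (exists_ins_of_mate i hi w hw x).choose).choose_spec
    exact ins_injective i (h2.symm.trans ((congrArg w.mate h1.symm).trans (w.mate_mate _)))
  mate_ne x hx := by
    have h1 := (exists_ins_of_mate i hi w hw x).choose_spec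
    rw [hx] at h1
    exact w.mate_ne _ h1
  noncrossing x y := by
    have h1 := (exists_ins_of_mate i hi w hw x).choose_spec
    have h2 := (exists_ins_of_mate i hi w hw y).choose_spec
    have h := w.noncrossing (ins i x) (ins i y)
    rw [h1, h2] at h
    simp only [Fin.lt_def, val_ins] at h ⊢
    split_ifs at h <;> omega

end BasisWeb

/-! ### Linear operations on web spaces -/

/-- Create an arc with ends `i` and `i + 1` in every basis web. -/
def birth {m : ℕ} (i : ℕ) (hi : i ≤ m) : WebSpace m →ₗ[K] WebSpace (m + 2) :=
  Finsupp.linearCombination K fun w => Finsupp.single (w.birth i hi) 1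

open Classical in
/-- The scalar produced when the ends `i` and `i + 1` of `w` are joined: `-[2]` if this closes up a
loop, and `1` otherwise. -/
def loopFactor {m : ℕ} (i : ℕ) (hi : i + 1 < m) (w : BasisWeb m) : K :=
  if (w.mate ⟨i, by omega⟩).val = i + 1 then -qInt 2 else 1

/-- Join the ends `i` and `i + 1` by an arc, then create a new arc with ends `i` and `i + 1`; a
closed loop is replaced by the factor `-[2]`. -/
def turnback {m : ℕ} (i : ℕ) (hi : i + 1 < m) : WebSpace m →ₗ[K] WebSpace m :=
  Finsupp.linearCombination K fun w => Finsupp.single (w.turnback i hi) (loopFactor i hi w)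

/-- Join the ends `i` and `i + 1` by an arc; a closed loop is replaced by the factor `-[2]`. -/
def join {m : ℕ} (i : ℕ) (hi : i ≤ m) : WebSpace (m + 2) →ₗ[K] WebSpace m :=
  Finsupp.linearCombination K fun w =>
    Finsupp.single
      ((w.turnback i (by omega)).removeArc i hi (by simp [BasisWeb.turnback, BasisWeb.turnbackMate]))
      (loopFactor i (by omega) w)

/-! ### Tangle diagrams and the Kauffman bracket -/

/-- Tangle diagrams in `D_m`, presented by building them up from the empty disk, each step adding
one elementary piece next to the boundary (the real axis, below the part already drawn). Every
tangle diagram is isotopic to one of this form. -/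
inductive TangleDiagram : ℕ → Type
  /-- The empty diagram. -/
  | empty : TangleDiagram 0
  /-- Add an arc joining two new neighbouring marked points, which get the numbers `i`, `i + 1`. -/
  | birth {m : ℕ} (i : ℕ) (hi : i ≤ m) (D : TangleDiagram m) : TangleDiagram (m + 2)
  /-- Join the ends `i` and `i + 1` by an arc. -/
  | join {m : ℕ} (i : ℕ) (hi : i ≤ m) (D : TangleDiagram (m + 2)) : TangleDiagram m
  /-- Let the strands ending at `i` and `i + 1` cross; the strand running from the upper right to
  the lower left passes over the other one. -/
  | cross {m : ℕ} (i : ℕ) (hi : i + 1 < m) (D : TangleDiagram m) : TangleDiagram m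
  /-- Let the strands ending at `i` and `i + 1` cross; the strand running from the upper left to
  the lower right passes over the other one. -/
  | crossInv {m : ℕ} (i : ℕ) (hi : i + 1 < m) (D : TangleDiagram m) : TangleDiagram m

/-- The Kauffman bracket. A crossing whose overpassing strand is the one with positive slope is
`q^{1/4}` times the vertical smoothing (both strands go straight down) plus `q^{-1/4}` times the
horizontal smoothing (both strands turn back); for the other crossing the two coefficients are
exchanged. A closed loop is `-[2]`. -/
def bracket {m : ℕ} : TangleDiagram m → WebSpace m
  | .empty => Finsupp.single BasisWeb.empty 1
  | .birth i hi D => birth i hi (bracket D)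
  | .join i hi D => join i hi (bracket D)
  | .cross i hi D => q4 • bracket D + q4⁻¹ • turnback i hi (bracket D)
  | .crossInv i hi D => q4⁻¹ • bracket D + q4 • turnback i hi (bracket D)

namespace TangleDiagram

/-- The same diagram with the number of marked points rewritten. -/
def cast {m m' : ℕ} (h : m = m') (D : TangleDiagram m) : TangleDiagram m' := h ▸ D

/-- Add `l` parallel (that is, nested) arcs, whose `2 l` ends are inserted in front of the marked
point with number `p`. -/
def arcs {m : ℕ} (p : ℕ) (hp : p ≤ m) (D : TangleDiagram m) : (l : ℕ) → TangleDiagram (m + 2 * l)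
  | 0 => D
  | l + 1 => birth (m := m + 2 * l) (p + l) (by omega) (arcs p hp D l)

/-- Let the strand ending at `p` cross under its next `b` neighbours, which end at
`p + 1, …, p + b`. -/
def slide {m : ℕ} (p : ℕ) (D : TangleDiagram m) : (b : ℕ) → (hb : p + b < m) → TangleDiagram m
  | 0, _ => D
  | b + 1, hb => cross (p + b) (by omega) (slide p D b (by omega))

/-- Let `a` parallel strands ending at `p, …, p + a - 1` cross the `b` parallel strands ending at
`p + a, …, p + a + b - 1`. The latter strands, which run from the upper right to the lower left,
pass over the former ones. -/
def cableCross {m : ℕ} (p b : ℕ) : (a : ℕ) → (h : p + a + b ≤ m) → TangleDiagram m → TangleDiagram m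
  | 0, _, D => D
  | a + 1, h, D => cableCross p b a (by omega) (slide (p + a) D b (by omega))

/-- The full twist of two bands of `n` parallel strands. The marked points are, counterclockwise,
the `n` lower right, the `n` upper right, the `n` upper left and the `n` lower left ends: `2 n`
parallel strands run from left to right, and then the lower band and the upper band
cross twice at the right end. -/
def fullTwist (n : ℕ) : TangleDiagram (4 * n) :=
  cableCross 0 n n (by omega) (cableCross 0 n n (by omega)
    ((empty.arcs 0 le_rfl (2 * n)).cast (by omega)))

/-- The crossingless diagram in which the lower left and lower right ends are joined by `k` parallel
arcs, as are the upper left and upper right ends, and in which the upper right and lower right ends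
are joined by `n - k` parallel arcs, as are the upper left and lower left ends. The marked points
are numbered as in `fullTwist`. -/
def through (n k : ℕ) (hk : k ≤ n) : TangleDiagram (4 * n) :=
  (((empty.arcs 0 le_rfl (2 * k)).arcs k (by omega) (n - k)).arcs (k + 2 * (n - k) + 2 * k)
    (by omega) (n - k)).cast (by omega)

end TangleDiagram

/-! ### Clasps -/

/-- Glue the `A_1` clasp (Jones-Wenzl projector) on `n` strands to the ends `p, …, p + n - 1`. The
clasp on at most one strand is trivial, and the clasp on `n + 2` strands is the sum of
* the clasp on the first `n + 1` strands next to a straight strand, and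
* `[n + 1] / [n + 2]` times the clasp on the first `n + 1` strands, followed by the web in which the
  first `n` strands are straight and the last two turn back, followed by the clasp on the first
  `n + 1` strands. -/
def clasp {m : ℕ} (p : ℕ) : (n : ℕ) → (h : p + n ≤ m) → WebSpace m →ₗ[K] WebSpace m
  | 0, _ => LinearMap.id
  | 1, _ => LinearMap.id
  | n + 2, h =>
    clasp p (n + 1) (by omega) +
      (qInt (n + 1) / qInt (n + 2)) •
        (clasp p (n + 1) (by omega) ∘ₗ turnback (p + n) (by omega) ∘ₗ clasp p (n + 1) (by omega))

/-- Glue four clasps to a web on `D_{4n}`, one to each of the four groups of `n` consecutive marked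
points. The range of this map is the clasped web space `W_{(n,n,n,n)}`. -/
def clasped (n : ℕ) : WebSpace (4 * n) →ₗ[K] WebSpace (4 * n) :=
  clasp 0 n (by omega) ∘ₗ clasp n n (by omega) ∘ₗ
    clasp (2 * n) n (by omega) ∘ₗ clasp (3 * n) n (by omega)

end A1Web

end

noncomputable section

namespace A1Web

/-! ### Creating and joining arcs of noncrossing matchings. -/

namespace BasisWeb

/-! The twisting happens at the right ends, the points `0, …, 2n - 1`. Let `φ` be the product of the
two right clasps, and let `x` be `2n` nested arcs with the two left clasps glued on. The left clasps
commute with the twist, so the task is to compute `φ (twist x)`. Both sides annihilate turnbacks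
inside either band: `φ` because clasps absorb turnbacks (`clasp_kills`), and `x` because a turnback
on nested arcs reappears at the mirrored place on the left, where a left clasp absorbs it
(`killed_clasp_clasp_nest`).

The heart is `twist_expansion`: for bands of `a` and `b` strands and any such `φ`, `x`, the value `φ
(twist x)` is a combination of the `φ (rainbow j x)`. It is proved by induction on `a`. Sliding the
strand at `p` across the rest of the first band multiplies `x` by `q4 ^ a` only. After this slide,
naturality (`Intertwines`) carries the twist of the other `a` strands past the slides, so that the
two passages of a single strand across the second band become adjacent. Such a double passage equals
`q4 ^ (2b)` plus `twistCoeff b` times one turnback (`slideL_slideR`). The first term leaves the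
twist of `a` and `b` strands. In the second, the cap is pulled through the twist by Reidemeister II
moves (`cap_slideR_twist`), leaving the twist of `a` and `b - 1` strands between a cap and a cup.
The resulting recursion of Pascal type is solved by `rainbowCoeff` (`rainbowCoeff_succ_succ`).

For `a = b = n` and `j = n - k` the coefficient is the stated one, and `rainbow j` turns the nested
arcs into `through n k` (`rainbow_nest`). The Temperley-Lieb relations used on the way are derived
from the matchings themselves. -/

theorem mate_birth_ins {m : ℕ} (i : ℕ) (hi : i ≤ m) (w : BasisWeb m) (y : Fin m) :
    (w.birth i hi).mate (ins i y) = ins i (w.mate y) :=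
  birthMate_ins i hi w.mate y

theorem mate_birth_left {m : ℕ} (i : ℕ) (hi : i ≤ m) (w : BasisWeb m) (x : Fin (m + 2))
    (hx : x.val = i) : ((w.birth i hi).mate x).val = i + 1 :=
  birthMate_left i hi w.mate x hx

theorem mate_birth_right {m : ℕ} (i : ℕ) (hi : i ≤ m) (w : BasisWeb m) (x : Fin (m + 2))
    (hx : x.val = i + 1) : ((w.birth i hi).mate x).val = i :=
  birthMate_right i hi w.mate x hx

/-- The involution of `removeArc` is obtained by choice and is visible only after `ins`. Equalities
of webs involving it are therefore tested through this injection. -/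
theorem ins_mate_removeArc {m : ℕ} (i : ℕ) (hi : i ≤ m) (w : BasisWeb (m + 2))
    (hw : (w.mate ⟨i, by omega⟩).val = i + 1) (x : Fin m) :
    ins i ((w.removeArc i hi hw).mate x) = w.mate (ins i x) :=
  (exists_ins_of_mate i hi w hw x).choose_spec.symm

/-- A web with an arc joining `i` and `i + 1` is determined by the rest. -/
theorem eq_birth {m : ℕ} (i : ℕ) (hi : i ≤ m) (w : BasisWeb (m + 2)) (v : BasisWeb m)
    (hw : (w.mate ⟨i, by omega⟩).val = i + 1) (h : ∀ y, w.mate (ins i y) = ins i (v.mate y)) :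
    w = v.birth i hi := by
  ext x : 2
  rcases eq_or_ins i hi x with hx | hx | ⟨y, rfl⟩
  · have : x = ⟨i, by omega⟩ := Fin.ext hx
    apply Fin.ext
    rw [mate_birth_left _ _ _ _ hx, this, hw]
  · have h1 : w.mate ⟨i, by omega⟩ = x := Fin.ext (hw.trans hx.symm)
    apply Fin.ext
    rw [mate_birth_right _ _ _ _ hx, ← h1, w.mate_mate]
  · rw [h, mate_birth_ins]

/-- Join the ends `i` and `i + 1` of a basis web by an arc, dropping a closed loop. -/
def joined {m : ℕ} (i : ℕ) (hi : i ≤ m) (w : BasisWeb (m + 2)) : BasisWeb m :=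
  (w.turnback i (by omega)).removeArc i hi (by simp [turnback, turnbackMate])

theorem turnback_eq {m : ℕ} (i : ℕ) (hi : i ≤ m) (w : BasisWeb (m + 2)) :
    w.turnback i (by omega) = (w.joined i hi).birth i hi :=
  eq_birth _ _ _ _ (by simp [turnback, turnbackMate]) fun y => (ins_mate_removeArc _ _ _ _ y).symm

/-- The involution of `joined`, in terms of the ends to be joined. -/
theorem ins_mate_joined {m : ℕ} (i : ℕ) (hi : i ≤ m) (w : BasisWeb (m + 2)) (y : Fin m) :
    ins i ((w.joined i hi).mate y) =
      if w.mate (ins i y) = ⟨i, by omega⟩ then w.mate ⟨i + 1, by omega⟩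
      else if w.mate (ins i y) = ⟨i + 1, by omega⟩ then w.mate ⟨i, by omega⟩
      else w.mate (ins i y) := by
  have hv := val_ins i y
  rw [joined, ins_mate_removeArc]
  simp only [turnback, turnbackMate]
  rw [if_neg, if_neg]
  · intro h; rw [h] at hv; simp only at hv; split_ifs at hv <;> omega
  · intro h; rw [h] at hv; simp only at hv; split_ifs at hv <;> omega

theorem ext_ins {m : ℕ} (i : ℕ) (v w : BasisWeb m)
    (h : ∀ x, ins i (v.mate x) = ins i (w.mate x)) : v = w := by
  ext x : 2
  exact ins_injective i (h x)

/-- The simplicial-type identity behind the commutation of arcs at distant places. -/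
theorem ins_ins {m : ℕ} (i l : ℕ) (hil : i ≤ l) (x : Fin m) :
    ins (l + 2) (ins i x) = ins i (ins l x) := by
  apply Fin.ext
  simp only [val_ins]
  split_ifs <;> omega

theorem ins_ne_left {m : ℕ} (i : ℕ) (x : Fin m) (h : i < m + 2) : ins i x ≠ ⟨i, h⟩ := by
  intro e
  have hv := val_ins i x
  rw [e] at hv
  simp only at hv
  split_ifs at hv <;> omega

theorem ins_ne_right {m : ℕ} (i : ℕ) (x : Fin m) (h : i + 1 < m + 2) : ins i x ≠ ⟨i + 1, h⟩ := by
  intro e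
  have hv := val_ins i x
  rw [e] at hv
  simp only at hv
  split_ifs at hv <;> omega

theorem joined_birth {m : ℕ} (i : ℕ) (hi : i ≤ m) (w : BasisWeb m) :
    (w.birth i hi).joined i hi = w := by
  apply ext_ins i
  intro x
  rw [ins_mate_joined, mate_birth_ins, if_neg (ins_ne_left _ _ _), if_neg (ins_ne_right _ _ _)]

/-- Straightening a zigzag: the strand that ended at `i` now ends at `i + 2`, which becomes `i`
again once `i` and `i + 1` are removed. -/
theorem joined_birth_succ {m : ℕ} (i : ℕ) (hi : i + 1 ≤ m) (w : BasisWeb m) :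
    (w.birth (i + 1) hi).joined i (by omega) = w := by
  have e1 : (w.birth (i + 1) hi).mate ⟨i + 1, by omega⟩ = ⟨i + 2, by omega⟩ :=
    Fin.ext (mate_birth_left _ _ _ _ rfl)
  have e2 : (w.birth (i + 1) hi).mate ⟨i + 2, by omega⟩ = ⟨i + 1, by omega⟩ :=
    Fin.ext (mate_birth_right _ _ _ _ rfl)
  have e3 : ins (i + 1) (⟨i, by omega⟩ : Fin m) = ⟨i, by omega⟩ := Fin.ext (by simp [val_ins])
  have e4 : ins i (⟨i, by omega⟩ : Fin m) = ⟨i + 2, by omega⟩ := Fin.ext (by simp [val_ins])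
  have e5 : ∀ y : Fin m, y.val ≠ i → ins i y = ins (i + 1) y := fun y hy =>
    Fin.ext (by simp only [val_ins]; split_ifs <;> omega)
  have e6 := mate_birth_ins (i + 1) hi w ⟨i, by omega⟩
  rw [e3] at e6
  apply ext_ins i
  intro x
  have hne := w.mate_ne x
  rw [ins_mate_joined, e1, e6]
  by_cases hx : x.val = i
  · have hx' : x = ⟨i, by omega⟩ := Fin.ext hx
    rw [hx'] at hne ⊢
    rw [e4, e2, if_neg (by simp), if_pos rfl, e5 _ (fun h => hne (Fin.ext h))]
  · rw [e5 x hx, mate_birth_ins]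
    by_cases hy : (w.mate x).val = i
    · have hy' : w.mate x = ⟨i, by omega⟩ := Fin.ext hy
      rw [hy', e3, if_pos rfl, e4]
    · rw [← e5 _ hy, if_neg (ins_ne_left _ _ _), if_neg (ins_ne_right _ _ _)]

theorem joined_succ_birth {m : ℕ} (i : ℕ) (hi : i + 1 ≤ m) (w : BasisWeb m) :
    (w.birth i (by omega)).joined (i + 1) hi = w := by
  have e1 : (w.birth i (by omega)).mate ⟨i, by omega⟩ = ⟨i + 1, by omega⟩ :=
    Fin.ext (mate_birth_left _ _ _ _ rfl)
  have e2 : (w.birth i (by omega)).mate ⟨i + 1, by omega⟩ = ⟨i, by omega⟩ :=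
    Fin.ext (mate_birth_right _ _ _ _ rfl)
  have e3 : ins (i + 1) (⟨i, by omega⟩ : Fin m) = ⟨i, by omega⟩ := Fin.ext (by simp [val_ins])
  have e4 : ins i (⟨i, by omega⟩ : Fin m) = ⟨i + 2, by omega⟩ := Fin.ext (by simp [val_ins])
  have e5 : ∀ y : Fin m, y.val ≠ i → ins (i + 1) y = ins i y := fun y hy =>
    Fin.ext (by simp only [val_ins]; split_ifs <;> omega)
  have e6 := mate_birth_ins i (by omega) w ⟨i, by omega⟩
  rw [e4] at e6
  apply ext_ins (i + 1)
  intro x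
  have hne := w.mate_ne x
  rw [ins_mate_joined, e2, e6]
  by_cases hx : x.val = i
  · have hx' : x = ⟨i, by omega⟩ := Fin.ext hx
    rw [hx'] at hne ⊢
    rw [e3, e1, if_pos rfl, e5 _ (fun h => hne (Fin.ext h))]
  · rw [e5 x hx, mate_birth_ins]
    by_cases hy : (w.mate x).val = i
    · have hy' : w.mate x = ⟨i, by omega⟩ := Fin.ext hy
      rw [hy', e3, e4, if_neg (by simp), if_pos rfl]
    · rw [← e5 _ hy, if_neg (ins_ne_left _ _ _), if_neg (ins_ne_right _ _ _)]

theorem birth_birth {m : ℕ} (i l : ℕ) (hil : i ≤ l) (hl : l ≤ m) (w : BasisWeb m) :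
    (w.birth l hl).birth i (by omega) = (w.birth i (by omega)).birth (l + 2) (by omega) := by
  apply eq_birth
  · have e : (⟨l + 2, by omega⟩ : Fin (m + 2 + 2)) = ins i ⟨l, by omega⟩ :=
      Fin.ext (by simp [val_ins, hil])
    have h := mate_birth_left l hl w ⟨l, by omega⟩ rfl
    rw [e, mate_birth_ins, val_ins]
    split_ifs <;> omega
  · intro y
    rcases eq_or_ins i (by omega) y with hy | hy | ⟨y, rfl⟩
    · apply Fin.ext
      rw [mate_birth_left _ _ _ _ (by rw [val_ins]; split_ifs <;> omega), val_ins,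
        mate_birth_left _ _ _ _ hy]
      split_ifs <;> omega
    · apply Fin.ext
      rw [mate_birth_right _ _ _ _ (by rw [val_ins]; split_ifs <;> omega), val_ins,
        mate_birth_right _ _ _ _ hy]
      split_ifs <;> omega
    · rw [ins_ins _ _ hil, mate_birth_ins, mate_birth_ins, mate_birth_ins, ins_ins _ _ hil]

/-- Arcs at the two ends of `ins i`, after a `birth` at a later place. -/
theorem mate_birth_add_two {m : ℕ} (i l : ℕ) (hil : i ≤ l) (hl : l ≤ m) (w : BasisWeb (m + 2))
    (x : Fin (m + 2)) (hx : x.val ≤ i + 1) :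
    (w.birth (l + 2) (by omega)).mate ⟨x.val, by omega⟩ = ins (l + 2) (w.mate x) := by
  rw [← mate_birth_ins (l + 2) (by omega)]
  congr 1
  exact Fin.ext (by simp only [val_ins]; split_ifs <;> omega)

theorem mate_birth_of_le {m : ℕ} (i l : ℕ) (hil : i ≤ l) (hl : l ≤ m) (w : BasisWeb (m + 2))
    (x : Fin (m + 2)) (hx : l ≤ x.val) :
    (w.birth i (by omega)).mate ⟨x.val + 2, by omega⟩ = ins i (w.mate x) := by
  rw [← mate_birth_ins i (by omega)]
  congr 1
  exact Fin.ext (by simp only [val_ins]; split_ifs <;> omega)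

theorem joined_birth_add_two {m : ℕ} (i l : ℕ) (hil : i ≤ l) (hl : l ≤ m) (w : BasisWeb (m + 2)) :
    (w.birth (l + 2) (by omega)).joined i (by omega) =
      (w.joined i (by omega)).birth l hl := by
  have e0 := mate_birth_add_two i l hil hl w ⟨i, by omega⟩ (by simp)
  have e1 := mate_birth_add_two i l hil hl w ⟨i + 1, by omega⟩ (by simp)
  have s0 : (⟨i, by omega⟩ : Fin (m + 2 + 2)) = ins (l + 2) ⟨i, by omega⟩ :=
    Fin.ext (by simp only [val_ins]; split_ifs <;> omega)
  have s1 : (⟨i + 1, by omega⟩ : Fin (m + 2 + 2)) = ins (l + 2) ⟨i + 1, by omega⟩ :=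
    Fin.ext (by simp only [val_ins]; split_ifs <;> omega)
  simp only at e0 e1
  have inj := ins_injective (m := m + 2) (l + 2)
  apply eq_birth
  · have h := ins_mate_joined i (by omega) (w.birth (l + 2) (by omega)) ⟨l, by omega⟩
    have e : ins i (⟨l, by omega⟩ : Fin (m + 2)) = ⟨l + 2, by omega⟩ :=
      Fin.ext (by simp only [val_ins]; split_ifs <;> omega)
    have e' : (w.birth (l + 2) (by omega)).mate ⟨l + 2, by omega⟩ = ⟨l + 3, by omega⟩ :=
      Fin.ext (mate_birth_left _ _ _ _ rfl)
    rw [e, e', if_neg (by simp; omega), if_neg (by simp; omega)] at h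
    have h' := congrArg Fin.val h
    rw [val_ins] at h'
    simp only at h'
    split_ifs at h' <;> omega
  · intro y
    apply ins_injective i
    rw [ins_mate_joined, e0, e1, ← ins_ins _ _ hil, ← ins_ins _ _ hil, mate_birth_ins,
      ins_mate_joined, s0, s1]
    simp only [inj.eq_iff]
    split_ifs <;> rfl

theorem joined_add_two_birth {m : ℕ} (i l : ℕ) (hil : i ≤ l) (hl : l ≤ m) (w : BasisWeb (m + 2)) :
    (w.birth i (by omega)).joined (l + 2) (by omega) =
      (w.joined l (by omega)).birth i (by omega) := by
  have e0 := mate_birth_of_le i l hil hl w ⟨l, by omega⟩ (by simp)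
  have e1 := mate_birth_of_le i l hil hl w ⟨l + 1, by omega⟩ (by simp)
  have s0 : (⟨l + 2, by omega⟩ : Fin (m + 2 + 2)) = ins i ⟨l, by omega⟩ :=
    Fin.ext (by simp only [val_ins]; split_ifs <;> omega)
  have s1 : (⟨l + 2 + 1, by omega⟩ : Fin (m + 2 + 2)) = ins i ⟨l + 1, by omega⟩ :=
    Fin.ext (by simp only [val_ins]; split_ifs <;> omega)
  have s1' : (⟨l + 1 + 2, by omega⟩ : Fin (m + 2 + 2)) = ins i ⟨l + 1, by omega⟩ := s1
  simp only at e0 e1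
  have inj := ins_injective (m := m + 2) i
  apply eq_birth
  · have h := ins_mate_joined (l + 2) (by omega) (w.birth i (by omega)) ⟨i, by omega⟩
    have e : ins (l + 2) (⟨i, by omega⟩ : Fin (m + 2)) = ⟨i, by omega⟩ :=
      Fin.ext (by simp only [val_ins]; split_ifs <;> omega)
    have e' : (w.birth i (by omega)).mate ⟨i, by omega⟩ = ⟨i + 1, by omega⟩ :=
      Fin.ext (mate_birth_left _ _ _ _ rfl)
    rw [e, e', if_neg (by simp; omega), if_neg (by simp; omega)] at h
    have h' := congrArg Fin.val h
    rw [val_ins] at h'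
    simp only at h'
    split_ifs at h' <;> omega
  · intro y
    apply ins_injective (l + 2)
    rw [ins_mate_joined, ins_ins _ _ hil, ins_ins _ _ hil, mate_birth_ins, ins_mate_joined]
    rw [s1'] at e1
    rw [s0] at e0
    rw [s1, s0, e0, e1]
    simp only [inj.eq_iff]
    split_ifs <;> rfl

/-- The effect on the involution `f` of joining the ends `a` and `b`. -/
def contract {X : Type*} [DecidableEq X] (f : X → X) (a b x : X) : X :=
  if f x = a then f b else if f x = b then f a else f x

/-- Either order of joining follows the same path from `x` through the two new arcs until it leaves
`a, b, c, d`. -/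
theorem contract_contract {X : Type*} [DecidableEq X] (f : X → X) (hf : ∀ x, f (f x) = x)
    (a b c d x : X) (hab : a ≠ b) (hac : a ≠ c) (had : a ≠ d) (hbc : b ≠ c) (hbd : b ≠ d)
    (hcd : c ≠ d) (hxa : x ≠ a) (hxb : x ≠ b) (hxc : x ≠ c) (hxd : x ≠ d) :
    contract (contract f c d) a b x = contract (contract f a b) c d x := by
  have ha := hf a
  have hb := hf b
  have hc := hf c
  have hd := hf d
  have hx := hf x
  unfold contract
  grind

theorem ins_mate_joined_eq_contract {m : ℕ} (i : ℕ) (hi : i ≤ m) (w : BasisWeb (m + 2))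
    (y : Fin m) : ins i ((w.joined i hi).mate y) =
      contract w.mate ⟨i, by omega⟩ ⟨i + 1, by omega⟩ (ins i y) :=
  ins_mate_joined i hi w y

theorem apply_contract {X Y : Type*} [DecidableEq X] [DecidableEq Y] (e : X → Y)
    (he : Function.Injective e) (f : X → X) (g : Y → Y) (h : ∀ x, e (f x) = g (e x)) (a b x : X) :
    e (contract f a b x) = contract g (e a) (e b) (e x) := by
  simp only [contract, ← h, he.eq_iff]
  split_ifs <;> rfl

theorem joined_joined {m : ℕ} (i l : ℕ) (hil : i ≤ l) (hl : l ≤ m) (w : BasisWeb (m + 2 + 2)) :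
    (w.joined (l + 2) (by omega)).joined i (by omega) =
      (w.joined i (by omega)).joined l hl := by
  have a1 : ins (l + 2) (⟨i, by omega⟩ : Fin (m + 2)) = ⟨i, by omega⟩ :=
    Fin.ext (by simp only [val_ins]; split_ifs <;> omega)
  have a2 : ins (l + 2) (⟨i + 1, by omega⟩ : Fin (m + 2)) = ⟨i + 1, by omega⟩ :=
    Fin.ext (by simp only [val_ins]; split_ifs <;> omega)
  have a3 : ins i (⟨l, by omega⟩ : Fin (m + 2)) = ⟨l + 2, by omega⟩ :=
    Fin.ext (by simp only [val_ins]; split_ifs <;> omega)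
  have a4 : ins i (⟨l + 1, by omega⟩ : Fin (m + 2)) = ⟨l + 2 + 1, by omega⟩ :=
    Fin.ext (by simp only [val_ins]; split_ifs <;> omega)
  apply ext_ins i
  intro x
  apply ins_injective (l + 2)
  rw [ins_mate_joined_eq_contract,
    apply_contract _ (ins_injective _) _ _ (ins_mate_joined_eq_contract _ _ _), a1, a2,
    ins_ins _ _ hil, ins_ins _ _ hil, ins_mate_joined_eq_contract,
    apply_contract _ (ins_injective _) _ _ (ins_mate_joined_eq_contract _ _ _), a3, a4]
  apply contract_contract _ w.mate_mate
  any_goals simp only [ne_eq, Fin.mk.injEq]; omega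
  · exact ins_ne_left _ _ _
  · exact ins_ne_right _ _ _
  · rw [← ins_ins _ _ hil]; exact ins_ne_left _ _ _
  · rw [← ins_ins _ _ hil]; exact ins_ne_right _ _ _

end BasisWeb

/-! ### Relations between the linear operations -/

/-- `birth` at an arbitrary place, zero if there is no such place. -/
def cup {m : ℕ} (i : ℕ) : WebSpace m →ₗ[K] WebSpace (m + 2) :=
  if hi : i ≤ m then birth i hi else 0

/-- `join` at an arbitrary place, zero if there is no such place. -/
def cap {m : ℕ} (i : ℕ) : WebSpace (m + 2) →ₗ[K] WebSpace m :=
  if hi : i ≤ m then join i hi else 0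

/-- `turnback` at an arbitrary place, zero if there is no such place. -/
def hook {m : ℕ} (i : ℕ) : Module.End K (WebSpace m) :=
  if hi : i + 1 < m then turnback i hi else 0

theorem birth_single {m : ℕ} (i : ℕ) (hi : i ≤ m) (w : BasisWeb m) :
    birth i hi (Finsupp.single w 1) = Finsupp.single (w.birth i hi) 1 := by
  simp [birth]

theorem join_single {m : ℕ} (i : ℕ) (hi : i ≤ m) (w : BasisWeb (m + 2)) :
    join i hi (Finsupp.single w 1) = loopFactor i (by omega) w • Finsupp.single (w.joined i hi) 1 := by
  simp [join, BasisWeb.joined]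

theorem turnback_eq {m : ℕ} (i : ℕ) (hi : i ≤ m) :
    turnback (m := m + 2) i (by omega) = birth i hi ∘ₗ join i hi := by
  refine Finsupp.lhom_ext' fun w => LinearMap.ext_ring ?_
  simp only [LinearMap.comp_apply, Finsupp.lsingle_apply, join_single, map_smul, birth_single,
    ← BasisWeb.turnback_eq]
  simp [turnback]

theorem hook_eq {m : ℕ} (i : ℕ) (x : WebSpace (m + 2)) : hook i x = cup i (cap i x) := by
  unfold hook cup cap
  by_cases hi : i ≤ m
  · rw [dif_pos (by omega), dif_pos hi, dif_pos hi, turnback_eq i hi]; rfl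
  · rw [dif_neg (by omega), dif_neg hi, dif_neg hi]; rfl

theorem loopFactor_birth {m : ℕ} (i : ℕ) (hi : i ≤ m) (w : BasisWeb m) :
    loopFactor i (by omega) (w.birth i hi) = -qInt 2 := by
  have h := BasisWeb.mate_birth_left i hi w ⟨i, by omega⟩ rfl
  rw [loopFactor, if_pos h]

theorem loopFactor_birth_succ {m : ℕ} (i : ℕ) (hi : i + 1 ≤ m) (w : BasisWeb m) :
    loopFactor i (by omega) (w.birth (i + 1) hi) = 1 := by
  rw [loopFactor, if_neg]
  intro h
  have h1 : (w.birth (i + 1) hi).mate ⟨i, by omega⟩ = ⟨i + 1, by omega⟩ := Fin.ext h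
  have h2 := (w.birth (i + 1) hi).mate_mate ⟨i, by omega⟩
  have h3 := BasisWeb.mate_birth_left (i + 1) hi w ⟨i + 1, by omega⟩ rfl
  rw [h1] at h2
  rw [h2] at h3
  simp only at h3
  omega

theorem loopFactor_succ_birth {m : ℕ} (i : ℕ) (hi : i + 1 ≤ m) (w : BasisWeb m) :
    loopFactor (i + 1) (by omega) (w.birth i (by omega)) = 1 := by
  rw [loopFactor, if_neg]
  rw [BasisWeb.mate_birth_right i _ w _ rfl]
  omega

theorem loopFactor_birth_add_two {m : ℕ} (i l : ℕ) (hil : i ≤ l) (hl : l ≤ m)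
    (w : BasisWeb (m + 2)) :
    loopFactor i (by omega) (w.birth (l + 2) (by omega)) = loopFactor i (by omega) w := by
  have e0 := BasisWeb.mate_birth_add_two i l hil hl w ⟨i, by omega⟩ (by simp)
  simp only at e0
  unfold loopFactor
  rw [e0]
  congr 1
  rw [BasisWeb.val_ins]
  split_ifs <;> simp
  omega

theorem loopFactor_add_two_birth {m : ℕ} (i l : ℕ) (hil : i ≤ l) (hl : l ≤ m)
    (w : BasisWeb (m + 2)) :
    loopFactor (l + 2) (by omega) (w.birth i (by omega)) = loopFactor l (by omega) w := by
  have e0 := BasisWeb.mate_birth_of_le i l hil hl w ⟨l, by omega⟩ (by simp)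
  simp only at e0
  unfold loopFactor
  rw [e0]
  congr 1
  rw [BasisWeb.val_ins]
  split_ifs <;> simp
  omega

theorem loopFactor_eq {m : ℕ} (i : ℕ) (hi : i + 1 < m) (w : BasisWeb m) :
    loopFactor i hi w = if w.mate ⟨i, by omega⟩ = ⟨i + 1, hi⟩ then -qInt 2 else 1 := by
  unfold loopFactor
  congr 1
  rw [Fin.ext_iff]

/-- A loop through only one of the two joins is counted at that join. A loop through both is counted
at whichever join comes second. -/
theorem loopFactor_joined {m : ℕ} (i l : ℕ) (hil : i ≤ l) (hl : l ≤ m)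
    (w : BasisWeb (m + 2 + 2)) :
    loopFactor (l + 2) (by omega) w * loopFactor i (by omega) (w.joined (l + 2) (by omega)) =
      loopFactor i (by omega) w * loopFactor l (by omega) (w.joined i (by omega)) := by
  have a1 : BasisWeb.ins (l + 2) (⟨i, by omega⟩ : Fin (m + 2)) = ⟨i, by omega⟩ :=
    Fin.ext (by simp only [BasisWeb.val_ins]; split_ifs <;> omega)
  have a2 : BasisWeb.ins (l + 2) (⟨i + 1, by omega⟩ : Fin (m + 2)) = ⟨i + 1, by omega⟩ :=
    Fin.ext (by simp only [BasisWeb.val_ins]; split_ifs <;> omega)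
  have a3 : BasisWeb.ins i (⟨l, by omega⟩ : Fin (m + 2)) = ⟨l + 2, by omega⟩ :=
    Fin.ext (by simp only [BasisWeb.val_ins]; split_ifs <;> omega)
  have a4 : BasisWeb.ins i (⟨l + 1, by omega⟩ : Fin (m + 2)) = ⟨l + 2 + 1, by omega⟩ :=
    Fin.ext (by simp only [BasisWeb.val_ins]; split_ifs <;> omega)
  have c1 := BasisWeb.ins_mate_joined (l + 2) (by omega) w ⟨i, by omega⟩
  have c2 := BasisWeb.ins_mate_joined i (by omega) w ⟨l, by omega⟩
  rw [a1] at c1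
  rw [a3] at c2
  have j1 := (BasisWeb.ins_injective (m := m + 2) (l + 2)).eq_iff
    (a := (w.joined (l + 2) (by omega)).mate ⟨i, by omega⟩) (b := ⟨i + 1, by omega⟩)
  have j2 := (BasisWeb.ins_injective (m := m + 2) i).eq_iff
    (a := (w.joined i (by omega)).mate ⟨l, by omega⟩) (b := ⟨l + 1, by omega⟩)
  rw [a2, c1] at j1
  rw [a4, c2] at j2
  rw [loopFactor_eq, loopFactor_eq, loopFactor_eq, loopFactor_eq]
  simp only [← j1, ← j2]
  have h := w.mate_mate
  have n1 : (⟨i, by omega⟩ : Fin (m + 2 + 2)) ≠ ⟨i + 1, by omega⟩ := by simp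
  have n2 : (⟨i, by omega⟩ : Fin (m + 2 + 2)) ≠ ⟨l + 2, by omega⟩ := by simp; omega
  have n3 : (⟨i, by omega⟩ : Fin (m + 2 + 2)) ≠ ⟨l + 2 + 1, by omega⟩ := by simp; omega
  have n4 : (⟨i + 1, by omega⟩ : Fin (m + 2 + 2)) ≠ ⟨l + 2, by omega⟩ := by simp; omega
  have n5 : (⟨i + 1, by omega⟩ : Fin (m + 2 + 2)) ≠ ⟨l + 2 + 1, by omega⟩ := by simp; omega
  have n6 : (⟨l + 2, by omega⟩ : Fin (m + 2 + 2)) ≠ ⟨l + 2 + 1, by omega⟩ := by simp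
  clear j1 j2 c1 c2 a1 a2 a3 a4
  generalize (⟨i, _⟩ : Fin (m + 2 + 2)) = a at *
  generalize (⟨i + 1, _⟩ : Fin (m + 2 + 2)) = b at *
  generalize (⟨l + 2, _⟩ : Fin (m + 2 + 2)) = c at *
  generalize (⟨l + 2 + 1, _⟩ : Fin (m + 2 + 2)) = d at *
  generalize w.mate = f at *
  have ha := h a
  have hb := h b
  have hc := h c
  have hd := h d
  clear h
  grind

theorem cap_cup {m : ℕ} (i : ℕ) (hi : i ≤ m) (x : WebSpace m) :
    cap i (cup i x) = -qInt 2 • x := by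
  unfold cup cap
  rw [dif_pos hi, dif_pos hi]
  revert x
  refine DFunLike.congr_fun (f := join i hi ∘ₗ birth i hi) (g := -qInt 2 • LinearMap.id) ?_
  refine Finsupp.lhom_ext' fun w => LinearMap.ext_ring ?_
  simp only [LinearMap.comp_apply, Finsupp.lsingle_apply, join_single, birth_single,
    loopFactor_birth, BasisWeb.joined_birth, LinearMap.smul_apply, LinearMap.id_apply]

theorem cap_cup_succ {m : ℕ} (i : ℕ) (hi : i + 1 ≤ m) (x : WebSpace m) :
    cap i (cup (i + 1) x) = x := by
  unfold cup cap
  rw [dif_pos hi, dif_pos (by omega)]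
  revert x
  refine DFunLike.congr_fun (f := join i _ ∘ₗ birth (i + 1) hi) (g := LinearMap.id) ?_
  refine Finsupp.lhom_ext' fun w => LinearMap.ext_ring ?_
  simp only [LinearMap.comp_apply, Finsupp.lsingle_apply, join_single, birth_single,
    loopFactor_birth_succ, BasisWeb.joined_birth_succ, one_smul, LinearMap.id_apply]

theorem cap_succ_cup {m : ℕ} (i : ℕ) (hi : i + 1 ≤ m) (x : WebSpace m) :
    cap (i + 1) (cup i x) = x := by
  unfold cup cap
  rw [dif_pos hi, dif_pos (by omega)]
  revert x
  refine DFunLike.congr_fun (f := join (i + 1) hi ∘ₗ birth i _) (g := LinearMap.id) ?_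
  refine Finsupp.lhom_ext' fun w => LinearMap.ext_ring ?_
  simp only [LinearMap.comp_apply, Finsupp.lsingle_apply, join_single, birth_single,
    BasisWeb.joined_succ_birth, LinearMap.id_apply]
  rw [loopFactor_succ_birth i hi, one_smul]

theorem cup_cup {m : ℕ} (i l : ℕ) (hil : i ≤ l) (x : WebSpace m) :
    cup i (cup l x) = cup (l + 2) (cup i x) := by
  unfold cup
  by_cases hl : l ≤ m
  · rw [dif_pos hl, dif_pos (by omega), dif_pos (by omega), dif_pos (by omega)]
    revert x
    refine DFunLike.congr_fun (f := birth i _ ∘ₗ birth l hl)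
      (g := birth (l + 2) _ ∘ₗ birth i _) ?_
    refine Finsupp.lhom_ext' fun w => LinearMap.ext_ring ?_
    simp only [LinearMap.comp_apply, Finsupp.lsingle_apply, birth_single,
      BasisWeb.birth_birth i l hil hl]
  · rw [dif_neg hl, dif_neg (c := l + 2 ≤ m + 2) (by omega)]
    simp

theorem cap_cap {m : ℕ} (i l : ℕ) (hil : i ≤ l) (x : WebSpace (m + 2 + 2)) :
    cap i (cap (l + 2) x) = cap l (cap i x) := by
  unfold cap
  by_cases hl : l ≤ m
  · rw [dif_pos hl, dif_pos (by omega), dif_pos (by omega), dif_pos (by omega)]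
    revert x
    refine DFunLike.congr_fun (f := join i _ ∘ₗ join (l + 2) _)
      (g := join l hl ∘ₗ join i _) ?_
    refine Finsupp.lhom_ext' fun w => LinearMap.ext_ring ?_
    simp only [LinearMap.comp_apply, Finsupp.lsingle_apply, join_single, map_smul, smul_smul,
      BasisWeb.joined_joined i l hil hl, loopFactor_joined i l hil hl]
  · rw [dif_neg hl, dif_neg (c := l + 2 ≤ m + 2) (by omega)]
    simp

theorem cap_cup_add_two {m : ℕ} (i l : ℕ) (hil : i ≤ l) (x : WebSpace (m + 2)) :
    cap i (cup (l + 2) x) = cup l (cap i x) := by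
  unfold cap cup
  by_cases hl : l ≤ m
  · rw [dif_pos hl, dif_pos (by omega), dif_pos (by omega), dif_pos (by omega)]
    revert x
    refine DFunLike.congr_fun (f := join i _ ∘ₗ birth (l + 2) _)
      (g := birth l hl ∘ₗ join i _) ?_
    refine Finsupp.lhom_ext' fun w => LinearMap.ext_ring ?_
    simp only [LinearMap.comp_apply, Finsupp.lsingle_apply, join_single, map_smul, birth_single,
      BasisWeb.joined_birth_add_two i l hil hl, loopFactor_birth_add_two i l hil hl]
  · rw [dif_neg hl, dif_neg (c := l + 2 ≤ m + 2) (by omega)]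
    simp

theorem cap_add_two_cup {m : ℕ} (i l : ℕ) (hil : i ≤ l) (x : WebSpace (m + 2)) :
    cap (l + 2) (cup i x) = cup i (cap l x) := by
  unfold cap cup
  by_cases hl : l ≤ m
  · rw [dif_pos hl, dif_pos (by omega), dif_pos (by omega), dif_pos (by omega)]
    revert x
    refine DFunLike.congr_fun (f := join (l + 2) _ ∘ₗ birth i _)
      (g := birth i _ ∘ₗ join l hl) ?_
    refine Finsupp.lhom_ext' fun w => LinearMap.ext_ring ?_
    simp only [LinearMap.comp_apply, Finsupp.lsingle_apply, join_single, map_smul, birth_single,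
      BasisWeb.joined_add_two_birth i l hil hl, loopFactor_add_two_birth i l hil hl]
  · rw [dif_neg hl, dif_neg (c := l + 2 ≤ m + 2) (by omega)]
    simp

/-! ### Scalars -/

theorem q4_ne_zero : q4 ≠ 0 := RatFunc.X_ne_zero

theorem q4_pow_ne_one {k : ℕ} (hk : 0 < k) : q4 ^ k ≠ 1 := by
  intro h
  have h2 : (algebraMap (Polynomial ℚ) K) (Polynomial.X ^ k) =
      (algebraMap (Polynomial ℚ) K) 1 := by
    rw [map_pow, map_one, RatFunc.algebraMap_X]; exact h
  have h3 := congrArg Polynomial.natDegree (RatFunc.algebraMap_injective ℚ h2)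
  simp at h3
  omega

theorem q_pow_ne_one {k : ℕ} (hk : 0 < k) : 1 - q ^ k ≠ 0 := by
  rw [q, ← pow_mul]
  exact sub_ne_zero.2 (q4_pow_ne_one (by omega)).symm

theorem brace_natCast (k : ℕ) : brace k = q4 ^ (2 * k) - (q4 ^ (2 * k))⁻¹ := by
  rw [brace, zpow_neg]
  norm_cast

theorem brace_ne_zero {k : ℕ} (hk : 0 < k) : brace k ≠ 0 := by
  rw [brace_natCast]
  intro h
  have h0 : q4 ^ (2 * k) ≠ 0 := pow_ne_zero _ q4_ne_zero
  apply q4_pow_ne_one (k := 2 * k + 2 * k) (by omega)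
  rw [pow_add]
  field_simp at h
  linear_combination h

theorem qInt_ne_zero {k : ℕ} (hk : 0 < k) : qInt k ≠ 0 :=
  div_ne_zero (brace_ne_zero hk) (by simpa using brace_ne_zero (k := 1) one_pos)

theorem qInt_two : qInt 2 = q4 ^ 2 + (q4 ^ 2)⁻¹ := by
  have h1 : brace 1 ≠ 0 := by simpa using brace_ne_zero (k := 1) one_pos
  have h := q4_ne_zero
  have e1 := brace_natCast 1
  have e2 := brace_natCast 2
  push_cast at e1 e2
  rw [qInt, div_eq_iff h1, e1, e2]
  field_simp
  ring

theorem qInt_recurrence (n : ℕ) :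
    qInt 2 * qInt ((n : ℤ) + 1) = qInt n + qInt ((n : ℤ) + 2) := by
  have h1 : brace 1 ≠ 0 := by simpa using brace_ne_zero (k := 1) one_pos
  have h := q4_ne_zero
  have e1 := brace_natCast n
  have e2 := brace_natCast (n + 1)
  have e3 := brace_natCast (n + 2)
  push_cast at e2 e3
  rw [qInt_two, qInt, qInt, qInt, ← add_div, ← mul_div_assoc, e1, e2, e3]
  congr 1
  simp only [mul_add, pow_add]
  field_simp
  ring

theorem neg_qInt_two : -qInt 2 = -(q4 ^ 2 + (q4 ^ 2)⁻¹) := by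
  rw [qInt_two]

/-! ### The Kauffman bracket relation in an algebra -/

section Smoothing

variable {F A : Type*} [Field F] [Ring A] [Algebra F A] {a d : F} {U V : A}

/-- The terms proportional to `U` have total coefficient `a ^ 2 + a⁻¹ ^ 2 + d = 0`. This
cancellation is what lets a turnback pass through two crossings. -/
theorem smoothing_mul_mul_left (ha : a ≠ 0) (hd : d = -(a ^ 2 + (a ^ 2)⁻¹)) (hU : U * U = d • U)
    (hUV : U * V * U = U) :
    (a • 1 + a⁻¹ • U) * (a • 1 + a⁻¹ • V) * U = V * U := by
  have e : (a • 1 + a⁻¹ • U) * (a • 1 + a⁻¹ • V) * U =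
      a ^ 2 • U + a⁻¹ ^ 2 • (U * V * U) + U * U + V * U := by
    simp only [add_mul, mul_add, smul_mul_assoc, mul_smul_comm, one_mul, mul_one]
    match_scalars <;> field_simp
  rw [e, hUV, hU, hd]
  match_scalars <;> field_simp
  ring

theorem mul_smoothing_mul_right (ha : a ≠ 0) (hd : d = -(a ^ 2 + (a ^ 2)⁻¹)) (hU : U * U = d • U)
    (hUV : U * V * U = U) :
    U * ((a • 1 + a⁻¹ • V) * (a • 1 + a⁻¹ • U)) = U * V := by
  have e : U * ((a • 1 + a⁻¹ • V) * (a • 1 + a⁻¹ • U)) =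
      a ^ 2 • U + a⁻¹ ^ 2 • (U * V * U) + U * U + U * V := by
    simp only [add_mul, mul_add, smul_mul_assoc, mul_smul_comm, one_mul, mul_one, ← mul_assoc]
    match_scalars <;> field_simp
  rw [e, hUV, hU, hd]
  match_scalars <;> field_simp
  ring

theorem smoothing_sq (ha : a ≠ 0) (hd : d = -(a ^ 2 + (a ^ 2)⁻¹)) (hU : U * U = d • U) :
    (a • 1 + a⁻¹ • U) * (a • 1 + a⁻¹ • U) = a ^ 2 • 1 + (1 - (a ^ 4)⁻¹) • U := by
  have e : (a • 1 + a⁻¹ • U) * (a • 1 + a⁻¹ • U) = a ^ 2 • 1 + (2 : F) • U + a⁻¹ ^ 2 • (U * U) := by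
    simp only [add_mul, mul_add, smul_mul_assoc, mul_smul_comm, one_mul, mul_one]
    match_scalars <;> field_simp
    ring
  rw [e, hU, hd]
  match_scalars <;> field_simp
  ring

theorem smoothing_mul_smoothing (ha : a ≠ 0) (U V : A) :
    (a • 1 + a⁻¹ • U) * V * (a • 1 + a⁻¹ • U) =
      a ^ 2 • V + U * V + V * U + (a ^ 2)⁻¹ • (U * V * U) := by
  simp only [add_mul, mul_add, smul_mul_assoc, mul_smul_comm, one_mul, mul_one]
  match_scalars <;> field_simp

theorem smoothing_smul {M : Type*} [AddCommGroup M] [Module F M] (ha : a ≠ 0)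
    (hd : d = -(a ^ 2 + (a ^ 2)⁻¹)) (x y : M) :
    a • a • x + a • a⁻¹ • y + (a⁻¹ • a • d • x + a⁻¹ • a⁻¹ • x) = y := by
  rw [hd]
  match_scalars <;> field_simp
  ring

end Smoothing

/-! ### The Temperley-Lieb relations -/

section TemperleyLieb

variable {m : ℕ}

theorem hook_of_not_lt (i : ℕ) (h : ¬ i + 1 < m) : hook (m := m) i = 0 := by
  rw [hook, dif_neg h]

theorem cap_hook (i : ℕ) (hi : i ≤ m) (x : WebSpace (m + 2)) :
    cap i (hook i x) = -qInt 2 • cap i x := by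
  rw [hook_eq, cap_cup i hi]

/-- Capping `hook i x` closes a loop, whose value `-[2]` is invertible. -/
theorem cap_eq_zero (i : ℕ) (hi : i ≤ m) (x : WebSpace (m + 2)) (h : hook i x = 0) :
    cap i x = 0 := by
  have h1 := cap_hook i hi x
  rw [h, map_zero, eq_comm, smul_eq_zero] at h1
  refine h1.resolve_left (neg_ne_zero.2 ?_)
  exact_mod_cast qInt_ne_zero (k := 2) two_pos

theorem cup_hook_of_le (i l : ℕ) (h : i ≤ l) (x : WebSpace m) :
    cup i (hook l x) = hook (l + 2) (cup i x) := by
  rcases Nat.lt_or_ge m 2 with hm | hm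
  · rw [hook_of_not_lt _ (by omega), hook_of_not_lt _ (by omega)]; simp
  · obtain ⟨m, rfl⟩ := Nat.exists_eq_add_of_le' hm
    rw [hook_eq, hook_eq, cup_cup i l h, cap_add_two_cup i l h]

theorem cup_add_two_hook (i l : ℕ) (h : i ≤ l) (x : WebSpace m) :
    cup (l + 2) (hook i x) = hook i (cup (l + 2) x) := by
  rcases Nat.lt_or_ge m 2 with hm | hm
  · rw [cup, dif_neg (by omega)]; simp
  · obtain ⟨m, rfl⟩ := Nat.exists_eq_add_of_le' hm
    rw [hook_eq, hook_eq, ← cup_cup i l h, cap_cup_add_two i l h]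

theorem cap_hook_add_two (i l : ℕ) (h : i ≤ l) (x : WebSpace (m + 2)) :
    cap i (hook (l + 2) x) = hook l (cap i x) := by
  rcases Nat.lt_or_ge m 2 with hm | hm
  · rw [hook_of_not_lt _ (by omega), hook_of_not_lt _ (by omega)]; simp
  · obtain ⟨m, rfl⟩ := Nat.exists_eq_add_of_le' hm
    rw [hook_eq, hook_eq, cap_cup_add_two i l h, cap_cap i l h]

theorem cap_add_two_hook (i l : ℕ) (h : i ≤ l) (x : WebSpace (m + 2)) :
    cap (l + 2) (hook i x) = hook i (cap (l + 2) x) := by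
  rcases Nat.lt_or_ge m 2 with hm | hm
  · rw [cap, dif_neg (by omega)]; simp
  · obtain ⟨m, rfl⟩ := Nat.exists_eq_add_of_le' hm
    rw [hook_eq, hook_eq, cap_add_two_cup i l h, cap_cap i l h]

theorem hook_mul_self (i : ℕ) : hook (m := m) i * hook i = -qInt 2 • hook i := by
  by_cases h : i + 1 < m
  · obtain ⟨m, rfl⟩ := Nat.exists_eq_add_of_le' (show 2 ≤ m by omega)
    refine LinearMap.ext fun x => ?_
    rw [Module.End.mul_apply, hook_eq i, cap_hook i (by omega), map_smul, LinearMap.smul_apply,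
      hook_eq]
  · rw [hook_of_not_lt i h]; simp

theorem hook_comm (i k : ℕ) (h : i + 2 ≤ k) :
    hook (m := m) i * hook k = hook k * hook i := by
  by_cases hk : k + 1 < m
  · obtain ⟨m, rfl⟩ := Nat.exists_eq_add_of_le' (show 2 ≤ m by omega)
    obtain ⟨l, rfl⟩ := Nat.exists_eq_add_of_le' (show 2 ≤ k by omega)
    refine LinearMap.ext fun x => ?_
    rw [Module.End.mul_apply, Module.End.mul_apply, hook_eq i, cap_hook_add_two i l (by omega),
      cup_hook_of_le i l (by omega), ← hook_eq]
  · rw [hook_of_not_lt k hk]; simp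

theorem hook_hook_succ_hook (i : ℕ) (h : i + 2 < m) :
    hook (m := m) i * hook (i + 1) * hook i = hook i := by
  obtain ⟨m, rfl⟩ := Nat.exists_eq_add_of_le' (show 2 ≤ m by omega)
  refine LinearMap.ext fun x => ?_
  rw [Module.End.mul_apply, Module.End.mul_apply, hook_eq i x, hook_eq (i + 1),
    cap_succ_cup i (by omega), hook_eq, cap_cup_succ i (by omega)]

theorem hook_succ_hook_hook_succ (i : ℕ) (h : i + 2 < m) :
    hook (m := m) (i + 1) * hook i * hook (i + 1) = hook (i + 1) := by
  obtain ⟨m, rfl⟩ := Nat.exists_eq_add_of_le' (show 2 ≤ m by omega)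
  refine LinearMap.ext fun x => ?_
  rw [Module.End.mul_apply, Module.End.mul_apply, hook_eq (i + 1) x, hook_eq i,
    cap_cup_succ i (by omega), hook_eq, cap_succ_cup i (by omega)]

/-! ### Crossings -/

/-- The linear operation of adding a crossing. -/
def crossing (i : ℕ) : Module.End K (WebSpace m) := q4 • 1 + q4⁻¹ • hook i

theorem crossing_apply (i : ℕ) (x : WebSpace m) : crossing i x = q4 • x + q4⁻¹ • hook i x := rfl

theorem crossing_mul_succ_mul_hook (i : ℕ) (h : i + 2 < m) :
    crossing (m := m) i * crossing (i + 1) * hook i = hook (i + 1) * hook i :=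
  smoothing_mul_mul_left (A := Module.End K (WebSpace m)) q4_ne_zero neg_qInt_two (hook_mul_self i) (hook_hook_succ_hook i h)

theorem crossing_succ_mul_mul_hook (i : ℕ) (h : i + 2 < m) :
    crossing (m := m) (i + 1) * crossing i * hook (i + 1) = hook i * hook (i + 1) :=
  smoothing_mul_mul_left (A := Module.End K (WebSpace m)) q4_ne_zero neg_qInt_two (hook_mul_self (i + 1))
    (hook_succ_hook_hook_succ i h)

theorem hook_succ_mul_crossing_mul_succ (i : ℕ) (h : i + 2 < m) :
    hook (m := m) (i + 1) * (crossing i * crossing (i + 1)) = hook (i + 1) * hook i :=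
  mul_smoothing_mul_right (A := Module.End K (WebSpace m)) q4_ne_zero neg_qInt_two (hook_mul_self (i + 1))
    (hook_succ_hook_hook_succ i h)

theorem hook_mul_crossing_succ_mul (i : ℕ) (h : i + 2 < m) :
    hook (m := m) i * (crossing (i + 1) * crossing i) = hook i * hook (i + 1) :=
  mul_smoothing_mul_right (A := Module.End K (WebSpace m)) q4_ne_zero neg_qInt_two (hook_mul_self i) (hook_hook_succ_hook i h)

theorem crossing_sq (i : ℕ) :
    crossing (m := m) i * crossing i = q4 ^ 2 • 1 + (1 - (q4 ^ 4)⁻¹) • hook i :=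
  smoothing_sq (A := Module.End K (WebSpace m)) q4_ne_zero neg_qInt_two (hook_mul_self i)

theorem crossing_hook_succ_crossing (i : ℕ) :
    crossing (m := m) i * hook (i + 1) * crossing i =
      q4 ^ 2 • hook (i + 1) + hook i * hook (i + 1) + hook (i + 1) * hook i +
        (q4 ^ 2)⁻¹ • (hook i * hook (i + 1) * hook i) :=
  smoothing_mul_smoothing (A := Module.End K (WebSpace m)) q4_ne_zero _ _

/-- A second Reidemeister move: an arc lying across a strand is pulled off it. The loop value makes
all smoothings but one cancel. -/
theorem cap_crossing_crossing (i : ℕ) (hi : i + 1 ≤ m) (x : WebSpace (m + 2)) :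
    cap (i + 1) (crossing i (crossing (i + 1) x)) = cap i x := by
  simp only [crossing_apply, map_add, map_smul, smul_add, hook_eq]
  rw [cap_cup (i + 1) hi, cap_succ_cup i hi, cap_succ_cup i hi, cap_cup_succ i hi]
  exact smoothing_smul (M := WebSpace m) q4_ne_zero neg_qInt_two _ _

end TemperleyLieb

/-! ### Operators intertwining two ranges of turnbacks -/

/-- The operator `L` carries the turnbacks of the `N` strands ending at `p, …` to those of the `N`
strands ending at `p', …`. -/
def Intertwines {m m' : ℕ} (L : WebSpace m →ₗ[K] WebSpace m') (p p' N : ℕ) : Prop :=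
  ∀ i, i + 1 < N → ∀ x, L (hook (p + i) x) = hook (p' + i) (L x)

namespace Intertwines

variable {m m' m'' : ℕ} {p p' p'' N : ℕ}

theorem mono {L : WebSpace m →ₗ[K] WebSpace m'} (h : Intertwines L p p' N) {N' : ℕ} (k : ℕ)
    (hk : k + N' ≤ N) : Intertwines L (p + k) (p' + k) N' := by
  intro i hi x
  rw [add_assoc, add_assoc]
  exact h (k + i) (by omega) x

theorem one : Intertwines (1 : Module.End K (WebSpace m)) p p N := fun _ _ _ => rfl

theorem mul {L L' : Module.End K (WebSpace m)} (h : Intertwines L p' p'' N)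
    (h' : Intertwines L' p p' N) : Intertwines (L * L') p p'' N := by
  intro i hi x
  rw [Module.End.mul_apply, Module.End.mul_apply, h' i hi, h i hi]

theorem crossing {L : WebSpace m →ₗ[K] WebSpace m'} (h : Intertwines L p p' N) (i : ℕ)
    (hi : i + 1 < N) (x : WebSpace m) :
    L (crossing (p + i) x) = A1Web.crossing (p' + i) (L x) := by
  rw [crossing_apply, crossing_apply, map_add, map_smul, map_smul, h i hi]

theorem hook_far (k : ℕ) (h : p + N ≤ k ∨ k + 2 ≤ p) :
    Intertwines (hook (m := m) k) p p N := by
  intro i hi x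
  rw [← Module.End.mul_apply, ← Module.End.mul_apply]
  rcases h with h | h
  · rw [hook_comm (p + i) k (by omega)]
  · rw [hook_comm k (p + i) (by omega)]

theorem crossing_far (k : ℕ) (h : p + N ≤ k ∨ k + 2 ≤ p) :
    Intertwines (A1Web.crossing (m := m) k) p p N := by
  intro i hi x
  simp only [crossing_apply, map_add, map_smul, hook_far k h i hi]

end Intertwines

/-! ### Strands sliding across bands -/

section Slide

variable {m m' : ℕ}

/-- The strand ending at `p` slides across its next `b` neighbours. -/
def slideR (p : ℕ) : ℕ → Module.End K (WebSpace m)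
  | 0 => 1
  | b + 1 => crossing (p + b) * slideR p b

/-- The strand ending at `p + b` slides across the `b` neighbours in front of it. -/
def slideL (p : ℕ) : ℕ → Module.End K (WebSpace m)
  | 0 => 1
  | b + 1 => slideL p b * crossing (p + b)

theorem slideR_succ' (p b : ℕ) :
    slideR (m := m) p (b + 1) = slideR (p + 1) b * crossing p := by
  induction b with
  | zero => simp [slideR]
  | succ b ih =>
    rw [slideR, ih, slideR, mul_assoc]
    congr 2
    omega

theorem slideL_succ' (p b : ℕ) :
    slideL (m := m) p (b + 1) = crossing p * slideL (p + 1) b := by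
  induction b with
  | zero => simp [slideL]
  | succ b ih =>
    rw [slideL, ih, slideL, mul_assoc]
    congr 3
    omega

theorem slideR_add (p a b : ℕ) :
    slideR (m := m) p (a + b) = slideR (p + a) b * slideR p a := by
  induction b with
  | zero => simp [slideR]
  | succ b ih => rw [← add_assoc, slideR, ih, slideR, mul_assoc, add_assoc]

namespace Intertwines

variable {p p' N : ℕ}

theorem slideR_apply {L : WebSpace m →ₗ[K] WebSpace m'} {b : ℕ} (h : Intertwines L p p' N)
    (hb : b < N) (x : WebSpace m) : L (slideR p b x) = slideR p' b (L x) := by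
  induction b with
  | zero => rfl
  | succ b ih =>
    rw [slideR, slideR, Module.End.mul_apply, Module.End.mul_apply, h.crossing b hb,
      ih (by omega)]

theorem slideL_apply {L : WebSpace m →ₗ[K] WebSpace m'} {b : ℕ} (h : Intertwines L p p' N)
    (hb : b < N) (x : WebSpace m) : L (slideL p b x) = slideL p' b (L x) := by
  induction b generalizing x with
  | zero => rfl
  | succ b ih =>
    rw [slideL, slideL, Module.End.mul_apply, Module.End.mul_apply, ih (by omega),
      h.crossing b hb]

theorem slideR_far (q b : ℕ) (h : p + N ≤ q ∨ q + b + 1 ≤ p) :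
    Intertwines (slideR (m := m) q b) p p N := by
  induction b with
  | zero => exact one
  | succ b ih => exact (crossing_far _ (by omega)).mul (ih (by omega))

theorem slideL_far (q b : ℕ) (h : p + N ≤ q ∨ q + b + 1 ≤ p) :
    Intertwines (slideL (m := m) q b) p p N := by
  induction b with
  | zero => exact one
  | succ b ih => exact (ih (by omega)).mul (crossing_far _ (by omega))

/-- Naturality of the braiding: a turnback of the crossed strands passes through the sliding strand.
-/
theorem slideR (p b : ℕ) (h : p + b < m) : Intertwines (slideR (m := m) p b) (p + 1) p b := by
  induction b with
  | zero => intro i hi; omega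
  | succ b ih =>
    intro i hi x
    rcases Nat.lt_or_ge (i + 1) b with hb | hb
    · rw [A1Web.slideR, Module.End.mul_apply, ih (by omega) i hb]
      exact crossing_far (N := b) (p + b) (Or.inl le_rfl) i hb _
    -- The turnback involves the two strands crossed last: it commutes with the first `i` crossings
    -- and passes through the remaining two.
    · obtain rfl : b = i + 1 := by omega
      rw [A1Web.slideR, A1Web.slideR, Module.End.mul_apply, Module.End.mul_apply,
        Module.End.mul_apply, Module.End.mul_apply]
      have h1 := slideR_far (m := m) (p := p + i + 1) (N := 2) p i (by omega) 0 (by omega) x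
      rw [add_zero, add_right_comm] at h1
      rw [h1]
      have h2 := crossing_succ_mul_mul_hook (m := m) (p + i) (by omega)
      rw [← hook_mul_crossing_succ_mul (m := m) (p + i) (by omega), mul_assoc] at h2
      rw [add_right_comm]
      exact LinearMap.congr_fun h2 _

theorem slideL (p b : ℕ) (h : p + b < m) : Intertwines (slideL (m := m) p b) p (p + 1) b := by
  induction b with
  | zero => intro i hi; omega
  | succ b ih =>
    intro i hi x
    rcases Nat.lt_or_ge (i + 1) b with hb | hb
    · rw [A1Web.slideL, Module.End.mul_apply, Module.End.mul_apply, ← ih (by omega) i hb]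
      congr 1
      exact crossing_far (N := b) (p + b) (Or.inl le_rfl) i hb _
    · obtain rfl : b = i + 1 := by omega
      rw [A1Web.slideL, A1Web.slideL, Module.End.mul_apply, Module.End.mul_apply,
        Module.End.mul_apply, Module.End.mul_apply]
      have h1 := slideL_far (m := m) (p := p + i + 1) (N := 2) p i (by omega) 0 (by omega)
      rw [add_zero] at h1
      rw [add_right_comm p 1 i, ← h1]
      congr 1
      have h2 := crossing_mul_succ_mul_hook (m := m) (p + i) (by omega)
      rw [← hook_succ_mul_crossing_mul_succ (m := m) (p + i) (by omega), mul_assoc] at h2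
      exact LinearMap.congr_fun h2 _

end Intertwines

end Slide

/-! ### Crossings of bands and the full twist -/

section Twist

variable {m m' : ℕ}

/-- The `a` strands ending at `p, …` cross the next `b` strands. -/
def bandCrossing (p b : ℕ) : ℕ → Module.End K (WebSpace m)
  | 0 => 1
  | a + 1 => bandCrossing p b a * slideR (p + a) b

/-- The full twist of the band of `a` strands ending at `p, …` and the next `b` strands. -/
def twist (p b : ℕ) : ℕ → Module.End K (WebSpace m)
  | 0 => 1
  | a + 1 => slideL (p + a) b * twist p b a * slideR (p + a) b

theorem Intertwines.bandCrossing_apply {L : WebSpace m →ₗ[K] WebSpace m'} {p p' N a b : ℕ}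
    (h : Intertwines L p p' N) (hN : a + b ≤ N) (x : WebSpace m) :
    L (bandCrossing p b a x) = bandCrossing p' b a (L x) := by
  induction a generalizing x with
  | zero => rfl
  | succ a ih =>
    rw [bandCrossing, bandCrossing, Module.End.mul_apply, Module.End.mul_apply, ih (by omega)]
    congr 1
    exact (h.mono (N' := b + 1) a (by omega)).slideR_apply (Nat.lt_succ_self b) x

theorem Intertwines.twist_apply {L : WebSpace m →ₗ[K] WebSpace m'} {p p' N a b : ℕ}
    (h : Intertwines L p p' N) (hN : a + b ≤ N) (x : WebSpace m) :
    L (twist p b a x) = twist p' b a (L x) := by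
  induction a generalizing x with
  | zero => rfl
  | succ a ih =>
    have h' := h.mono (N' := b + 1) a (by omega)
    simp only [twist, Module.End.mul_apply]
    rw [h'.slideL_apply (Nat.lt_succ_self b), ih (by omega),
      h'.slideR_apply (Nat.lt_succ_self b)]

/-- The crossings of two bands can be sorted by the strands of either one. The definition splits off
a strand of the first band, this lemma the last strand of the second. -/
theorem bandCrossing_succ (p a b : ℕ) :
    bandCrossing (m := m) p (a + 1) b = slideL (p + a) b * bandCrossing p a b := by
  induction b with
  | zero => simp [bandCrossing, slideL]
  | succ b ih =>
    rw [bandCrossing, ih, bandCrossing, slideR, slideL]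
    have h : bandCrossing (m := m) p a b * crossing (p + b + a) =
        crossing (p + a + b) * bandCrossing p a b := by
      refine LinearMap.ext fun x => ?_
      rw [Module.End.mul_apply, Module.End.mul_apply, add_right_comm,
        (Intertwines.crossing_far (N := a + b) (p := p) (p + a + b) (by omega)).bandCrossing_apply
          (by omega)]
    calc slideL (p + a) b * bandCrossing p a b * (crossing (p + b + a) * slideR (p + b) a)
        = slideL (p + a) b * (bandCrossing p a b * crossing (p + b + a)) * slideR (p + b) a := by
          simp only [mul_assoc]
      _ = _ := by rw [h]; simp only [mul_assoc]

theorem bandCrossing_mul_bandCrossing (p a b : ℕ) :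
    bandCrossing (m := m) p a b * bandCrossing p b a = twist p b a := by
  induction a with
  | zero =>
    have h : ∀ b, bandCrossing (m := m) p 0 b = 1 := by
      intro b
      induction b with
      | zero => rfl
      | succ b ih => rw [bandCrossing, ih, slideR, mul_one]
    rw [h, bandCrossing, twist, mul_one]
  | succ a ih =>
    rw [bandCrossing_succ, bandCrossing, twist, ← ih]
    simp only [mul_assoc]

/-- The full twist, with one strand of the second band singled out. -/
theorem twist_succ_left (p a b : ℕ) :
    twist (m := m) p (b + 1) a = slideR p a * twist (p + 1) b a * slideL p a := by
  induction a with
  | zero => simp [twist, slideR, slideL]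
  | succ a ih =>
    have h : slideL (m := m) (p + a + 1) b * slideR p a = slideR p a * slideL (p + a + 1) b := by
      refine LinearMap.ext fun x => ?_
      rw [Module.End.mul_apply, Module.End.mul_apply,
        (Intertwines.slideR_far (p := p + a + 1) (N := b + 1) p a (by omega)).slideL_apply
          (Nat.lt_succ_self b)]
    have h' : slideL (m := m) p a * slideR (p + a + 1) b = slideR (p + a + 1) b * slideL p a := by
      refine LinearMap.ext fun x => ?_
      rw [Module.End.mul_apply, Module.End.mul_apply,
        (Intertwines.slideL_far (p := p + a + 1) (N := b + 1) p a (by omega)).slideR_apply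
          (Nat.lt_succ_self b)]
    rw [twist, ih, slideL_succ', slideR_succ', slideR, slideL, twist, add_right_comm p 1 a]
    calc crossing (p + a) * slideL (p + a + 1) b *
          (slideR p a * twist (p + 1) b a * slideL p a) * (slideR (p + a + 1) b * crossing (p + a))
        = crossing (p + a) * (slideL (p + a + 1) b * slideR p a) * twist (p + 1) b a *
            (slideL p a * slideR (p + a + 1) b) * crossing (p + a) := by simp only [mul_assoc]
      _ = _ := by rw [h, h']; simp only [mul_assoc]

/-- The sliding strand crosses both bands, so their whole twist can be pushed through it. -/
theorem twist_slideR (p a b : ℕ) (h : p + a + b < m) (x : WebSpace m) :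
    twist p b a (slideR p (a + b) x) = slideR p (a + b) (twist (p + 1) b a x) :=
  ((Intertwines.slideR p (a + b) (by omega)).twist_apply le_rfl x).symm

/-! ### Vectors and linear maps killed by turnbacks -/

/-- The turnbacks of the `N` strands ending at `p, …` kill the vector `x`. -/
def Killed (x : WebSpace m) (p N : ℕ) : Prop := ∀ i, i + 1 < N → hook (p + i) x = 0

/-- The linear map `φ` kills the turnbacks of the `N` strands ending at `p, …`. -/
def Kills {V : Type*} [AddCommGroup V] [Module K V] (φ : WebSpace m →ₗ[K] V) (p N : ℕ) : Prop :=
  ∀ i, i + 1 < N → ∀ x, φ (hook (p + i) x) = 0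

theorem Intertwines.killed {L : WebSpace m →ₗ[K] WebSpace m'} {p p' N : ℕ}
    (h : Intertwines L p p' N) {x : WebSpace m} (hx : Killed x p N) : Killed (L x) p' N := by
  intro i hi
  rw [← h i hi, hx i hi, map_zero]

theorem Killed.mono {x : WebSpace m} {p N : ℕ} (h : Killed x p N) {N' : ℕ} (k : ℕ)
    (hk : k + N' ≤ N) : Killed x (p + k) N' := by
  intro i hi
  rw [add_assoc]
  exact h (k + i) (by omega)

theorem Kills.mono {V : Type*} [AddCommGroup V] [Module K V] {φ : WebSpace m →ₗ[K] V} {p N : ℕ}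
    (h : Kills φ p N) {N' : ℕ} (k : ℕ) (hk : k + N' ≤ N) : Kills φ (p + k) N' := by
  intro i hi
  rw [add_assoc]
  exact h (k + i) (by omega)

/-- Each strand of the first band shifts the turnbacks of the second one place down and then back
up. -/
theorem Killed.twist {x : WebSpace m} {p a b : ℕ} (h : p + a + b ≤ m) (hx : Killed x (p + a) b) :
    Killed (twist p b a x) (p + a) b := by
  induction a generalizing x with
  | zero => exact hx
  | succ a ih =>
    rw [A1Web.twist, Module.End.mul_apply, Module.End.mul_apply]
    refine (Intertwines.slideL (p + a) b (by omega)).killed (ih (by omega) ?_)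
    exact (Intertwines.slideR (p + a) b (by omega)).killed hx

/-- Inside a killed band every crossing reduces to its vertical smoothing, with coefficient `q4`. -/
theorem Killed.slideR_apply {x : WebSpace m} {p b : ℕ} (hx : Killed x p (b + 1)) :
    slideR p b x = q4 ^ b • x := by
  induction b with
  | zero => rw [slideR, pow_zero, one_smul, Module.End.one_apply]
  | succ b ih =>
    rw [slideR, Module.End.mul_apply, ih (hx.mono 0 (by omega)), map_smul, crossing_apply,
      hx b (by omega), smul_zero, add_zero, smul_smul, pow_succ]

theorem Kills.slideR_apply {V : Type*} [AddCommGroup V] [Module K V] {φ : WebSpace m →ₗ[K] V}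
    {p b : ℕ} (hφ : Kills φ p (b + 1)) (x : WebSpace m) : φ (slideR p b x) = q4 ^ b • φ x := by
  induction b with
  | zero => rw [slideR, pow_zero, one_smul, Module.End.one_apply]
  | succ b ih =>
    rw [slideR, Module.End.mul_apply, crossing_apply, map_add, map_smul, map_smul,
      hφ b (by omega), smul_zero, add_zero, ih (hφ.mono 0 (by omega)), smul_smul, pow_succ']

/-- A single strand twisting around a turnback. -/
theorem slideL_hook_slideR {V : Type*} [AddCommGroup V] [Module K V] {φ : WebSpace m →ₗ[K] V}
    {x : WebSpace m} {p b : ℕ} (h : p + b + 1 < m) (hx : Killed x (p + 1) (b + 1))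
    (hφ : Kills φ (p + 1) (b + 1)) :
    φ (slideL p b (hook (p + b) (slideR p b x))) = (q4 ^ (2 * b))⁻¹ • φ (hook p x) := by
  induction b with
  | zero => simp [slideL, slideR]
  | succ b ih =>
    have e := LinearMap.congr_fun (crossing_hook_succ_crossing (m := m) (p + b)) (slideR p b x)
    simp only [Module.End.mul_apply, LinearMap.add_apply, LinearMap.smul_apply] at e
    have e1 := Intertwines.slideR_far (m := m) (p := p + b + 1) (N := 2) p b (by omega) 0
      (by omega) x
    have e2 := fun y => Intertwines.slideL_far (m := m) (p := p + b + 1) (N := 2) p b (by omega) 0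
      (by omega) y
    have e3 := hx b (by omega)
    have e4 := hφ b (by omega)
    rw [add_right_comm] at e3
    simp only [add_right_comm p 1 b] at e4
    simp only [add_zero] at e1 e2
    have e5 : hook (p + b + 1) (slideR p b x) = 0 := by rw [← e1, e3, map_zero]
    have e6 := LinearMap.congr_fun (hook_hook_succ_hook (m := m) (p + b) (by omega))
      (slideR p b x)
    simp only [Module.End.mul_apply] at e6
    -- Of the four terms of `e`, those with `hook (p + b + 1)` at an end die: it commutes with the
    -- shorter slides and reaches `x` or `φ`. The last term contracts to `(q4 ^ 2)⁻¹` times `hook (p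
    -- + b)`.
    rw [slideL, slideR, Module.End.mul_apply, Module.End.mul_apply, ← add_assoc, e, e5, e6]
    simp only [map_add, map_smul, map_zero, smul_zero, zero_add]
    rw [e2, e4, zero_add, ih (by omega) (hx.mono 0 (by omega)) (hφ.mono 0 (by omega)), smul_smul,
      ← mul_inv, mul_add, pow_add, mul_one, mul_comm]

/-- The coefficient of the turnback in the full twist of one strand and `b` clasped strands. -/
def twistCoeff (b : ℕ) : K := (q4 ^ 2)⁻¹ * (q4 ^ (2 * b) - (q4 ^ (2 * b))⁻¹)

theorem twistCoeff_succ (b : ℕ) :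
    q4 ^ 2 * twistCoeff b + (1 - (q4 ^ 4)⁻¹) * (q4 ^ (2 * b))⁻¹ = twistCoeff (b + 1) := by
  have h := q4_ne_zero
  unfold twistCoeff
  rw [mul_add, pow_add]
  field_simp
  ring

/-- The two copies of the last crossing meet in the middle. In their square, the identity term
leaves a shorter double slide and the turnback term is `slideL_hook_slideR`, so the coefficient of
`hook p` builds up as a geometric sum. -/
theorem slideL_slideR {V : Type*} [AddCommGroup V] [Module K V] {φ : WebSpace m →ₗ[K] V}
    {x : WebSpace m} {p b : ℕ} (h : p + b < m) (hx : Killed x (p + 1) b)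
    (hφ : Kills φ (p + 1) b) :
    φ (slideL p b (slideR p b x)) = q4 ^ (2 * b) • φ x + twistCoeff b • φ (hook p x) := by
  induction b with
  | zero => simp [slideL, slideR, twistCoeff]
  | succ b ih =>
    have e := LinearMap.congr_fun (crossing_sq (m := m) (p + b)) (slideR p b x)
    simp only [Module.End.mul_apply, LinearMap.add_apply, LinearMap.smul_apply,
      Module.End.one_apply] at e
    rw [slideL, slideR, Module.End.mul_apply, Module.End.mul_apply, e]
    simp only [map_add, map_smul]
    rw [slideL_hook_slideR (by omega) hx hφ,
      ih (by omega) (hx.mono 0 (by omega)) (hφ.mono 0 (by omega)), smul_add, smul_smul, smul_smul,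
      smul_smul, add_assoc, ← add_smul, twistCoeff_succ, ← pow_add, mul_add, mul_one, add_comm 2]

/-! ### Joining two neighbouring strands after a slide -/

theorem slideR_succ_mul_slideR_succ (p a : ℕ) :
    slideR (m := m) p (a + 1) * slideR (p + 1) (a + 1) =
      crossing (p + a) * crossing (p + a + 1) * (slideR p a * slideR (p + 1) a) := by
  rw [slideR, slideR, add_right_comm p 1 a]
  have h : slideR (m := m) p a * crossing (p + a + 1) = crossing (p + a + 1) * slideR p a := by
    refine LinearMap.ext fun x => ?_
    have h1 := (Intertwines.slideR_far (m := m) (p := p + a + 1) (N := 2) p a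
      (by omega)).crossing 0 (by omega) x
    exact h1
  calc crossing (p + a) * slideR p a * (crossing (p + a + 1) * slideR (p + 1) a)
      = crossing (p + a) * (slideR p a * crossing (p + a + 1)) * slideR (p + 1) a := by
        simp only [mul_assoc]
    _ = _ := by rw [h]; simp only [mul_assoc]

/-- The arc is pulled off the `a` crossed strands one at a time. -/
theorem cap_slideR_slideR (p a : ℕ) (h : p + a ≤ m) (x : WebSpace (m + 2)) :
    cap (p + a) (slideR p a (slideR (p + 1) a x)) = cap p x := by
  induction a with
  | zero => rfl
  | succ a ih =>
    have e := LinearMap.congr_fun (slideR_succ_mul_slideR_succ (m := m + 2) p a) x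
    simp only [Module.End.mul_apply] at e
    rw [e, ← add_assoc, cap_crossing_crossing _ (by omega), ih (by omega)]

/-- The vertical smoothing of any crossing leaves a cap at a place where `x` is annihilated. Hence
every crossing contributes its horizontal smoothing, with `q4⁻¹`. -/
theorem cap_slideL {x : WebSpace (m + 2)} {p a : ℕ} (h : p + a ≤ m)
    (hx : ∀ i < a, cap (p + i) x = 0) :
    cap p (slideL (p + 1) a x) = (q4 ^ a)⁻¹ • cap (p + a) x := by
  induction a generalizing x with
  | zero => simp [slideL]
  | succ a ih =>
    rw [slideL, Module.End.mul_apply, ih (by omega), crossing_apply, map_add, map_smul, map_smul,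
      hx a (by omega), smul_zero, zero_add, hook_eq, add_right_comm p 1 a,
      cap_cup_succ _ (by omega), smul_smul, pow_succ, mul_inv, add_assoc]
    intro i hi
    obtain ⟨l, rfl⟩ := Nat.exists_eq_add_of_lt hi
    rw [crossing_apply, map_add, map_smul, map_smul, hx i (by omega),
      show p + 1 + (i + l + 1) = (p + i + l) + 2 by omega, cap_hook_add_two _ _ (by omega),
      hx i (by omega)]
    simp

/-- With the first strand of the second band singled out, the cap is pulled off the `a` strands,
moves freely past the smaller twist, and meets a slide that `cap_slideL` evaluates. -/
theorem cap_slideR_twist {x : WebSpace (m + 2)} {p a b : ℕ} (h : p + a + b ≤ m)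
    (hx : Killed x p (a + 1)) :
    cap (p + a) (slideR p a (twist (p + 1) (b + 1) a x)) =
      (q4 ^ a)⁻¹ • twist p b a (cap (p + a) x) := by
  have hc : Intertwines (cap (m := m) p) (p + 1 + 1) p (a + b) := by
    intro i _ x
    rw [show p + 1 + 1 + i = (p + i) + 2 by omega, cap_hook_add_two _ _ (by omega)]
  rw [twist_succ_left, Module.End.mul_apply, Module.End.mul_apply, cap_slideR_slideR _ _ (by omega),
    hc.twist_apply le_rfl, cap_slideL (by omega), map_smul]
  intro i hi
  exact cap_eq_zero _ (by omega) _ (hx i (by omega))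

/-! ### The expansion of the full twist -/

/-- Join `j` nested pairs of neighbouring strands, half of them ending in front of `M`, and create
`j` nested arcs at the same place. -/
def rainbow : (j M m : ℕ) → WebSpace m →ₗ[K] WebSpace m
  | 0, _, _ => LinearMap.id
  | j + 1, M + 1, m + 2 => cup M ∘ₗ rainbow j M m ∘ₗ cap M
  | _, _, _ => 0

/-- The product of the `1 - q^(a - l)` for `l < j`. -/
def descPoch (a j : ℕ) : K := ∏ l ∈ Finset.range j, (1 - q4 ^ (4 * ((a : ℤ) - l)))

/-- The coefficient of `rainbow j` in the full twist of `a` strands and `b` strands. -/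
def rainbowCoeff (a b j : ℕ) : K :=
  (-1) ^ j * q4 ^ (2 * (a : ℤ) * b - 4 * (a + b) * j + 4 * j ^ 2 - 2 * j) * descPoch a j *
    descPoch b j / qPoch j

/-! ### The coefficients of the expansion and their recursion. -/

theorem descPoch_succ (a j : ℕ) :
    descPoch a (j + 1) = descPoch a j * (1 - q4 ^ (4 * ((a : ℤ) - j))) :=
  Finset.prod_range_succ _ _

theorem descPoch_succ_succ (a j : ℕ) :
    descPoch (a + 1) (j + 1) = (1 - q4 ^ (4 * ((a : ℤ) + 1))) * descPoch a j := by
  rw [descPoch, Finset.prod_range_succ', mul_comm]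
  push_cast
  congr 1
  refine Finset.prod_congr rfl fun l _ => ?_
  congr 3
  ring

theorem descPoch_eq_zero {a j : ℕ} (h : a < j) : descPoch a j = 0 :=
  Finset.prod_eq_zero (Finset.mem_range.2 h) (by simp)

theorem qPoch_succ (k : ℕ) : qPoch (k + 1) = qPoch k * (1 - q ^ (k + 1)) :=
  Finset.prod_Icc_succ_top (by omega) _

theorem qPoch_ne_zero (k : ℕ) : qPoch k ≠ 0 :=
  Finset.prod_ne_zero_iff.2 fun _ hl => q_pow_ne_one (Finset.mem_Icc.1 hl).1

theorem rainbowCoeff_zero_right (a b : ℕ) : rainbowCoeff a b 0 = q4 ^ (2 * a * b) := by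
  simp only [rainbowCoeff, descPoch, qPoch]
  simp
  norm_cast

theorem rainbowCoeff_succ_zero (a b : ℕ) :
    rainbowCoeff (a + 1) b 0 = q4 ^ (2 * b) * rainbowCoeff a b 0 := by
  rw [rainbowCoeff_zero_right, rainbowCoeff_zero_right, ← pow_add]
  congr 1
  ring

/-- This allows sums over `j` whose range ignores `b`, or exceeds `a`. -/
theorem rainbowCoeff_eq_zero {a b j : ℕ} (h : a < j ∨ b < j) : rainbowCoeff a b j = 0 := by
  rcases h with h | h <;> simp [rainbowCoeff, descPoch_eq_zero h]

/-- A recursion of `q`-Pascal type. Once the common Pochhammer factors are split off, it is a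
rational identity in `q4`, `q4 ^ a`, `q4 ^ b` and `q4 ^ j`. -/
theorem rainbowCoeff_succ_succ (a b j : ℕ) :
    rainbowCoeff (a + 1) (b + 1) (j + 1) = q4 ^ (2 * (b + 1)) * rainbowCoeff a (b + 1) (j + 1) +
      (q4 ^ (2 * a))⁻¹ * twistCoeff (b + 1) * rainbowCoeff a b j := by
  have h0 := q4_ne_zero
  have hA : q4 ^ a ≠ 0 := pow_ne_zero _ h0
  have hB : q4 ^ b ≠ 0 := pow_ne_zero _ h0
  have hJ : q4 ^ j ≠ 0 := pow_ne_zero _ h0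
  have hq : 1 - (q4 ^ j) ^ 4 * q4 ^ 4 ≠ 0 := by
    have h := q_pow_ne_one (Nat.succ_pos j)
    rwa [q, ← pow_mul, Nat.succ_eq_add_one, mul_add, pow_add, mul_one, mul_comm 4, pow_mul] at h
  have hP := qPoch_ne_zero j
  have e1 : q4 ^ (4 * ((a : ℤ) + 1)) = (q4 ^ a) ^ 4 * q4 ^ 4 := by
    rw [← pow_mul, ← pow_add]; norm_cast; ring_nf
  have e2 : q4 ^ (4 * ((b : ℤ) + 1)) = (q4 ^ b) ^ 4 * q4 ^ 4 := by
    rw [← pow_mul, ← pow_add]; norm_cast; ring_nf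
  have e3 : q4 ^ (4 * ((a : ℤ) - j)) = (q4 ^ a) ^ 4 / (q4 ^ j) ^ 4 := by
    rw [mul_sub, zpow_sub₀ h0, ← pow_mul, ← pow_mul]; norm_cast; ring_nf
  have e4 : q ^ (j + 1) = (q4 ^ j) ^ 4 * q4 ^ 4 := by
    rw [q]; ring
  -- The exponent in `rainbowCoeff a b j`; the other two exponents are expressed relative to it.
  set z : ℤ := 2 * (a : ℤ) * b - 4 * (a + b) * j + 4 * j ^ 2 - 2 * j with hz
  have e5 : q4 ^ (2 * ((a + 1 : ℕ) : ℤ) * (b + 1 : ℕ) - 4 * ((a + 1 : ℕ) + (b + 1 : ℕ)) *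
      (j + 1 : ℕ) + 4 * (j + 1 : ℕ) ^ 2 - 2 * (j + 1 : ℕ)) =
      q4 ^ z / ((q4 ^ a) ^ 2 * (q4 ^ b) ^ 2 * q4 ^ 4) := by
    rw [← pow_mul, ← pow_mul, ← pow_add, ← pow_add, ← zpow_natCast, ← zpow_sub₀ h0]
    congr 1
    rw [hz]
    push_cast
    ring
  have e6 : q4 ^ (2 * (a : ℤ) * (b + 1 : ℕ) - 4 * (a + (b + 1 : ℕ)) *
      (j + 1 : ℕ) + 4 * (j + 1 : ℕ) ^ 2 - 2 * (j + 1 : ℕ)) =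
      q4 ^ z * (q4 ^ j) ^ 4 / ((q4 ^ a) ^ 2 * (q4 ^ b) ^ 4 * q4 ^ 2) := by
    rw [← pow_mul, ← pow_mul, ← pow_mul, ← pow_add, ← pow_add, ← zpow_natCast, ← zpow_natCast,
      ← zpow_add₀ h0, ← zpow_sub₀ h0]
    congr 1
    rw [hz]
    push_cast
    ring
  have e7 : twistCoeff (b + 1) =
      (q4 ^ 2)⁻¹ * ((q4 ^ b) ^ 2 * q4 ^ 2 - ((q4 ^ b) ^ 2 * q4 ^ 2)⁻¹) := by
    rw [twistCoeff, mul_add, pow_add, mul_comm 2, pow_mul, mul_one]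
  have e8 : q4 ^ (2 * (b + 1)) = (q4 ^ b) ^ 2 * q4 ^ 2 := by ring
  have e9 : q4 ^ (2 * a) = (q4 ^ a) ^ 2 := by ring
  rw [rainbowCoeff, rainbowCoeff, rainbowCoeff, e5, e6, e7, descPoch_succ_succ, descPoch_succ_succ,
    descPoch_succ, qPoch_succ, e1, e2, e3, e4, e8, e9, ← hz, pow_succ (-1 : K)]
  generalize q4 ^ a = A at *
  generalize q4 ^ b = B at *
  generalize q4 ^ j = J at *
  generalize q4 ^ z = Z at *
  generalize qPoch j = P at *
  generalize descPoch a j = Da at *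
  generalize descPoch b j = Db at *
  generalize q4 = t at *
  generalize (-1 : K) ^ j = s at *
  clear e1 e2 e3 e4 e5 e6 e7 e8 e9
  generalize hQ : 1 - J ^ 4 * t ^ 4 = Q at *
  field_simp
  rw [← hQ]
  ring

theorem twist_expansion {V : Type*} [AddCommGroup V] [Module K V] (a : ℕ) :
    ∀ (b : ℕ) {m p : ℕ} (x : WebSpace m) (φ : WebSpace m →ₗ[K] V), p + a + b ≤ m →
      Killed x p a → Killed x (p + a) b → Kills φ p a → Kills φ (p + a) b →
      φ (twist p b a x) =
        ∑ j ∈ Finset.range (a + 1), rainbowCoeff a b j • φ (rainbow j (p + a) m x) := by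
  induction a with
  | zero =>
    intro b m p x φ _ _ _ _ _
    rw [Finset.sum_range_one, rainbowCoeff_zero_right, mul_zero, zero_mul, pow_zero, one_smul]
    rfl
  | succ a ih =>
    intro b m p x φ hm hxA hxB hφA hφB
    rw [← add_assoc] at hm hxB hφB
    have h0 : q4 ^ a ≠ 0 := pow_ne_zero _ q4_ne_zero
    set y := twist (p + 1) b a x with hy
    have hyB : Killed (slideR p a y) (p + a + 1) b := by
      refine (Intertwines.slideR_far p a (Or.inr le_rfl)).killed ?_
      rw [add_right_comm] at hxB ⊢
      exact hxB.twist (by omega)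
    -- The factor `q4 ^ a` is traded for `slideR p a` on `x`. It merges with `slideR (p + a) b` into
    -- one long slide, which the smaller twist passes, bringing `slideL (p + a) b` next to `slideR
    -- (p + a) b`.
    have e1 : q4 ^ a • φ (twist p b (a + 1) x) =
        q4 ^ (2 * b) • q4 ^ a • φ y + twistCoeff b • φ (hook (p + a) (slideR p a y)) := by
      rw [← map_smul, ← map_smul, ← hxA.slideR_apply, twist, Module.End.mul_apply,
        Module.End.mul_apply, ← Module.End.mul_apply (slideR (p + a) b), ← slideR_add,
        twist_slideR _ _ _ (by omega), slideR_add, Module.End.mul_apply,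
        slideL_slideR (by omega) hyB hφB, hφA.slideR_apply]
    have e2 : φ y = ∑ j ∈ Finset.range (a + 1 + 1),
        rainbowCoeff a b j • φ (rainbow j (p + (a + 1)) m x) := by
      rw [Finset.sum_range_succ, rainbowCoeff_eq_zero (Or.inl (Nat.lt_succ_self a)), zero_smul,
        add_zero, hy]
      have e := ih b (p := p + 1) x φ (by omega) (hxA.mono 1 (by omega)) (by
        rw [add_right_comm]; exact hxB) (hφA.mono 1 (by omega)) (by
        rw [add_right_comm]; exact hφB)
      rw [e, add_right_comm, add_assoc]
    cases b with
    | zero =>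
      have hz : twistCoeff 0 = 0 := by simp [twistCoeff]
      rw [hz, zero_smul, add_zero, mul_zero, pow_zero, one_smul] at e1
      rw [smul_right_injective _ h0 e1, e2]
      refine Finset.sum_congr rfl fun j _ => ?_
      congr 1
      cases j with
      | zero => rw [rainbowCoeff_succ_zero, mul_zero, pow_zero, one_mul]
      | succ j => rw [rainbowCoeff_eq_zero (by omega), rainbowCoeff_eq_zero (by omega)]
    | succ b =>
      obtain ⟨m, rfl⟩ := Nat.exists_eq_add_of_le' (show 2 ≤ m by omega)
      -- The cap uses up the last strand of the first band and the first strand of the second. The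
      -- remaining turnbacks commute with cap and cup, so the new vector and functional still
      -- annihilate them.
      have e3 := ih b (p := p) (cap (p + a) x) (φ ∘ₗ cup (p + a)) (by omega)
        (by
          intro i hi
          obtain ⟨l, rfl⟩ := Nat.exists_eq_add_of_lt hi
          rw [show p + (i + 1 + l + 1) = (p + i + l) + 2 by omega,
            ← cap_add_two_hook _ _ (by omega), hxA i (by omega), map_zero])
        (by
          intro i hi
          rw [← cap_hook_add_two _ _ (by omega),
            show p + a + i + 2 = p + a + 1 + (i + 1) by omega, hxB (i + 1) (by omega), map_zero])
        (by
          intro i hi z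
          obtain ⟨l, rfl⟩ := Nat.exists_eq_add_of_lt hi
          rw [LinearMap.comp_apply, show p + (i + 1 + l + 1) = (p + i + l) + 2 by omega,
            cup_add_two_hook _ _ (by omega), hφA i (by omega)])
        (by
          intro i hi z
          rw [LinearMap.comp_apply, cup_hook_of_le _ _ (by omega),
            show p + a + i + 2 = p + a + 1 + (i + 1) by omega, hφB (i + 1) (by omega)])
      rw [hook_eq, hy, cap_slideR_twist (by omega) hxA, map_smul, map_smul, ← hy] at e1
      rw [LinearMap.comp_apply] at e3
      have e4 : φ (twist p (b + 1) (a + 1) x) = q4 ^ (2 * (b + 1)) • φ y +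
          ((q4 ^ (2 * a))⁻¹ * twistCoeff (b + 1)) • φ (cup (p + a) (twist p b a (cap (p + a) x))) := by
        apply smul_right_injective V h0
        simp only
        rw [e1, smul_add, smul_comm, smul_smul (twistCoeff _), smul_smul (q4 ^ a) (_ * _)]
        congr 2
        rw [two_mul a, pow_add]
        field_simp
      -- Splitting off `j = 0` aligns `rainbow (j + 1)` from the first term with a cup and cap
      -- around `rainbow j` from the second.
      rw [e4, e3, e2, Finset.sum_range_succ' _ (a + 1), Finset.sum_range_succ' _ (a + 1), smul_add,
        smul_smul, ← rainbowCoeff_succ_zero, add_right_comm, Finset.smul_sum, Finset.smul_sum,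
        ← Finset.sum_add_distrib]
      congr 1
      refine Finset.sum_congr rfl fun j _ => ?_
      rw [rainbowCoeff_succ_succ, add_smul, smul_smul, smul_smul]
      rfl

end Twist

/-! ### Clasps -/

section Clasp

variable {m m' : ℕ}

theorem hook_eq_turnback (i : ℕ) (h : i + 1 < m) : hook (m := m) i = turnback i h :=
  dif_pos h

theorem clasp_add_two (p n : ℕ) (h : p + (n + 2) ≤ m) (x : WebSpace m) :
    clasp p (n + 2) h x = clasp p (n + 1) (by omega) x +
      (qInt ((n : ℤ) + 1) / qInt ((n : ℤ) + 2)) •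
        clasp p (n + 1) (by omega) (hook (p + n) (clasp p (n + 1) (by omega) x)) := by
  rw [hook_eq_turnback (p + n) (by omega), clasp]
  rfl

theorem Intertwines.clasp_apply {L : WebSpace m →ₗ[K] WebSpace m'} {p p' n : ℕ}
    (hL : Intertwines L p p' n) (h : p + n ≤ m) (h' : p' + n ≤ m') (x : WebSpace m) :
    L (clasp p n h x) = clasp p' n h' (L x) := by
  induction n generalizing x with
  | zero => rfl
  | succ n ih =>
    cases n with
    | zero => rfl
    | succ n =>
      have ih' := ih (hL.mono 0 (by omega)) (by omega) (by omega)
      rw [clasp_add_two, clasp_add_two, map_add, map_smul, ih', ih', hL n (by omega), ih']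

theorem Intertwines.clasp_far {p N q n : ℕ} (hq : q + n ≤ m) (h : p + N ≤ q ∨ q + n ≤ p) :
    Intertwines (clasp (m := m) q n hq) p p N := by
  intro i hi x
  exact ((Intertwines.hook_far (m := m) (p := q) (N := n) (p + i) (by omega)).clasp_apply
    hq hq x).symm

/-- Every correction term of the clasp contains a turnback and dies under `φ`. When `φ` is itself a
clasp, this is idempotence. -/
theorem Kills.clasp_apply {V : Type*} [AddCommGroup V] [Module K V] {φ : WebSpace m →ₗ[K] V}
    {p n : ℕ} (hφ : Kills φ p n) (h : p + n ≤ m) (x : WebSpace m) : φ (clasp p n h x) = φ x := by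
  induction n generalizing x with
  | zero => rfl
  | succ n ih =>
    cases n with
    | zero => rfl
    | succ n =>
      have ih' := ih (hφ.mono 0 (by omega)) (by omega)
      rw [clasp_add_two, map_add, map_smul, ih', ih', hφ n (by omega), smul_zero, add_zero]

theorem qInt_one : qInt 1 = 1 :=
  div_self (by simpa using brace_ne_zero (k := 1) one_pos)

/-- Partial trace of a clasp, in the form in which it enters the absorption of turnbacks. -/
theorem hook_clasp_hook (p n : ℕ) (h : p + (n + 2) ≤ m)
    (hK : Kills (clasp (m := m) p n (by omega)) p n)
    (hK' : Kills (clasp (m := m) p (n + 1) (by omega)) p (n + 1)) (x : WebSpace m) :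
    clasp p (n + 1) (by omega) (hook (p + n) (clasp p (n + 1) (by omega) (hook (p + n) x))) =
      (-(qInt ((n : ℤ) + 2) / qInt ((n : ℤ) + 1))) •
        clasp p (n + 1) (by omega) (hook (p + n) x) := by
  have hs := fun y => LinearMap.congr_fun (hook_mul_self (m := m) (p + n)) y
  simp only [Module.End.mul_apply, LinearMap.smul_apply] at hs
  cases n with
  | zero =>
    simp only [clasp, LinearMap.id_apply]
    rw [hs]
    simp [qInt_one]
  | succ n =>
    have hc := (Intertwines.hook_far (m := m) (p := p) (N := n + 1) (p + (n + 1))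
      (by omega)).clasp_apply (by omega) (by omega)
    have hz := LinearMap.congr_fun (hook_succ_hook_hook_succ (m := m) (p + n) (by omega))
    simp only [Module.End.mul_apply, add_assoc] at hz
    -- The straight term of the larger clasp closes a loop, giving `-[2]`; the correction term
    -- contracts by the Temperley-Lieb relation `U U' U = U`.
    have e : hook (p + (n + 1)) (clasp p (n + 2) (by omega) (hook (p + (n + 1)) x)) =
        (-qInt 2 + qInt ((n : ℤ) + 1) / qInt ((n : ℤ) + 2)) •
          clasp p (n + 1) (by omega) (hook (p + (n + 1)) x) := by
      rw [clasp_add_two, map_add, map_smul, hc, hc, hs, map_smul, ← hc x, hz, hc,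
        hK.clasp_apply, add_smul]
    have h2 : qInt ((n : ℤ) + 2) ≠ 0 := by exact_mod_cast qInt_ne_zero (k := n + 2) (by omega)
    -- This turns `-[2] + [n + 1] / [n + 2]` into `-[n + 3] / [n + 2]`.
    have h3 := qInt_recurrence (n + 1)
    have hK'' : Kills (clasp (m := m) p (n + 1 + 1) (by omega)) p (n + 1) :=
      hK'.mono 0 (by omega)
    rw [e, map_smul, hK''.clasp_apply]
    congr 1
    push_cast at h3 ⊢
    rw [show (n : ℤ) + 1 + 1 = n + 2 by ring] at h3 ⊢
    field_simp
    linear_combination -h3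

/-- Clasps absorb turnbacks. -/
theorem clasp_kills (p n : ℕ) (h : p + n ≤ m) : Kills (clasp p n h) p n := by
  induction n using Nat.twoStepInduction with
  | zero => intro i hi; omega
  | one => intro i hi; omega
  | more n ih ih' =>
    intro i hi x
    specialize ih (by omega)
    specialize ih' (by omega)
    rw [clasp_add_two]
    rcases Nat.lt_or_ge (i + 1) (n + 1) with hin | hin
    · rw [ih' i hin, map_zero, map_zero, smul_zero, add_zero]
    -- For the last turnback, the coefficient in the recursion of the clasp is exactly the inverse,
    -- up to sign, of the partial trace.
    · obtain rfl : i = n := by omega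
      have h1 : qInt ((i : ℤ) + 1) ≠ 0 := by exact_mod_cast qInt_ne_zero (k := i + 1) (by omega)
      have h2 : qInt ((i : ℤ) + 2) ≠ 0 := by exact_mod_cast qInt_ne_zero (k := i + 2) (by omega)
      rw [hook_clasp_hook p i h ih ih', smul_smul, mul_neg, div_mul_div_cancel₀' h1, div_self h2,
        neg_smul, one_smul, add_neg_cancel]

theorem Kills.comp {V : Type*} [AddCommGroup V] [Module K V] {φ : WebSpace m' →ₗ[K] V}
    {p p' N : ℕ} (hφ : Kills φ p' N) {L : WebSpace m →ₗ[K] WebSpace m'} (hL : Intertwines L p p' N) :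
    Kills (φ ∘ₗ L) p N := by
  intro i hi x
  rw [LinearMap.comp_apply, hL i hi, hφ i hi]

theorem Kills.of_comp {L : WebSpace m →ₗ[K] WebSpace m'} {p N : ℕ} (hL : Kills L p N)
    {V : Type*} [AddCommGroup V] [Module K V] (φ : WebSpace m' →ₗ[K] V) : Kills (φ ∘ₗ L) p N := by
  intro i hi x
  rw [LinearMap.comp_apply, hL i hi, map_zero]

theorem Kills.cup_apply {V : Type*} [AddCommGroup V] [Module K V]
    {φ : WebSpace (m + 2) →ₗ[K] V} {p N : ℕ} (hφ : Kills φ p N) (h : p + N ≤ m + 2) (i : ℕ)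
    (hi : i + 1 < N) (x : WebSpace m) : φ (cup (p + i) x) = 0 := by
  have h1 := hφ i hi (cup (p + i) x)
  rw [hook_eq, cap_cup _ (by omega), map_smul, map_smul, smul_eq_zero] at h1
  refine h1.resolve_left (neg_ne_zero.2 ?_)
  exact_mod_cast qInt_ne_zero (k := 2) two_pos

end Clasp

/-! ### Nested arcs -/

section Arcs

/-- Rewriting the number of marked points. -/
def castWeb {m m' : ℕ} (h : m = m') : WebSpace m →ₗ[K] WebSpace m' := by
  subst h; exact LinearMap.id

theorem castWeb_castWeb {m m' m'' : ℕ} (h : m = m') (h' : m' = m'') (x : WebSpace m) :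
    castWeb h' (castWeb h x) = castWeb (h.trans h') x := by
  subst h h'; rfl

theorem cup_castWeb {m m' : ℕ} (h : m = m') (i : ℕ) (x : WebSpace m) :
    cup i (castWeb h x) = castWeb (by rw [h]) (cup i x) := by
  subst h; rfl

theorem Kills.castWeb_cup {V : Type*} [AddCommGroup V] [Module K V] {m m' : ℕ}
    {φ : WebSpace m' →ₗ[K] V} {p N : ℕ} (hφ : Kills φ p N) (h : m + 2 = m') (hp : p + N ≤ m') (i : ℕ)
    (hi : i + 1 < N) (x : WebSpace m) : φ (castWeb h (cup (p + i) x)) = 0 := by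
  subst h
  exact hφ.cup_apply hp i hi x

theorem hook_castWeb {m m' : ℕ} (h : m = m') (i : ℕ) (x : WebSpace m) :
    hook i (castWeb h x) = castWeb h (hook i x) := by
  subst h; rfl

theorem rainbow_castWeb {m m' : ℕ} (h : m = m') (j M : ℕ) (x : WebSpace m) :
    rainbow j M m' (castWeb h x) = castWeb h (rainbow j M m x) := by
  subst h; rfl

theorem bracket_cast {m m' : ℕ} (h : m = m') (D : TangleDiagram m) :
    bracket (D.cast h) = castWeb h (bracket D) := by
  subst h; rfl

variable {m : ℕ}

/-- Create `l` nested arcs in front of the marked point with number `p`. -/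
def arches (p : ℕ) : (l : ℕ) → WebSpace m →ₗ[K] WebSpace (m + 2 * l)
  | 0 => LinearMap.id
  | l + 1 => cup (m := m + 2 * l) (p + l) ∘ₗ arches p l

theorem arches_succ (p l : ℕ) (x : WebSpace m) :
    arches p (l + 1) x = cup (m := m + 2 * l) (p + l) (arches p l x) := rfl

theorem bracket_arcs (p : ℕ) (hp : p ≤ m) (D : TangleDiagram m) (l : ℕ) :
    bracket (D.arcs p hp l) = arches p l (bracket D) := by
  induction l with
  | zero => rfl
  | succ l ih =>
    rw [arches_succ, ← ih, cup, dif_pos (by omega)]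
    rfl

theorem cup_arches (i p l : ℕ) (h : i ≤ p) (x : WebSpace m) :
    cup i (arches p l x) = castWeb (by omega) (arches (p + 2) l (cup i x)) := by
  induction l with
  | zero => rfl
  | succ l ih =>
    rw [arches_succ, cup_cup i _ (by omega), ih, cup_castWeb, arches_succ, add_right_comm p l 2]

/-- The web consisting of `N` nested arcs. -/
def nest (N : ℕ) : WebSpace (0 + 2 * N) := arches 0 N (Finsupp.single BasisWeb.empty 1)

theorem nest_succ (N : ℕ) : nest (N + 1) = cup (m := 0 + 2 * N) N (nest N) :=
  congrArg (fun i => cup (m := 0 + 2 * N) i (nest N)) (zero_add N)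

/-- Joining the right ends of two adjacent nested arcs merges them into one arc between their left
ends, which are neighbours at the mirrored place. -/
theorem cap_nest (N i : ℕ) (hi : i ≤ N) :
    cap (m := 0 + 2 * (N + 1)) i (nest (N + 2)) = cup (m := 0 + 2 * N) (2 * N - i) (nest N) := by
  induction N with
  | zero =>
    obtain rfl : i = 0 := by omega
    rw [nest_succ (0 + 1)]
    exact cap_cup_succ 0 (by omega) _
  | succ N ih =>
    rcases Nat.lt_or_ge N i with h | h
    · obtain rfl : i = N + 1 := by omega
      rw [nest_succ (N + 1 + 1), show 2 * (N + 1) - (N + 1) = N + 1 by omega]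
      exact (cap_cup_succ (m := 0 + 2 * (N + 2)) (N + 1) (by omega) _).trans (nest_succ (N + 1))
    · rw [nest_succ (N + 1 + 1), show 2 * (N + 1) - i = 2 * N - i + 2 by omega]
      refine (cap_cup_add_two (m := 0 + 2 * (N + 1)) i N h (nest (N + 2))).trans ?_
      rw [ih h, nest_succ N]
      exact cup_cup (m := 0 + 2 * N) _ _ (by omega) _

theorem hook_nest (N i : ℕ) (hi : i ≤ N) :
    hook i (nest (N + 2)) =
      cup (m := 0 + 2 * (N + 1)) (2 * N - i + 2) (cup (m := 0 + 2 * N) i (nest N)) := by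
  refine (hook_eq (m := 0 + 2 * (N + 1)) i _).trans ?_
  rw [cap_nest N i hi]
  exact cup_cup (m := 0 + 2 * N) _ _ (by omega) _

theorem rainbow_cup (j M c : ℕ) (h : M + j ≤ c) (x : WebSpace m) :
    rainbow j M (m + 2) (cup c x) = cup c (rainbow j M m x) := by
  induction j generalizing M c m with
  | zero => simp [rainbow]
  | succ j ih =>
    cases M with
    | zero => simp [rainbow]
    | succ M =>
      rcases Nat.lt_or_ge m 2 with hm | hm
      · rw [cup, dif_neg (by omega)]; simp
      · obtain ⟨m, rfl⟩ := Nat.exists_eq_add_of_le' hm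
        obtain ⟨c, rfl⟩ := Nat.exists_eq_add_of_le' (show 2 ≤ c by omega)
        simp only [rainbow, LinearMap.comp_apply]
        rw [cap_cup_add_two _ _ (by omega), ih _ _ (by omega), cup_cup _ _ (by omega)]

theorem Intertwines.rainbow (j M p N : ℕ) (h : M + j ≤ p) :
    Intertwines (rainbow j M m) p p N := by
  induction j generalizing M p m with
  | zero => intro i hi x; simp [A1Web.rainbow]
  | succ j ih =>
    intro i hi x
    cases M with
    | zero => simp [A1Web.rainbow]
    | succ M =>
      rcases Nat.lt_or_ge m 2 with hm | hm
      · rw [hook_of_not_lt _ (by omega)]; simp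
      · obtain ⟨m, rfl⟩ := Nat.exists_eq_add_of_le' hm
        obtain ⟨p, rfl⟩ := Nat.exists_eq_add_of_le' (show 2 ≤ p by omega)
        simp only [A1Web.rainbow, LinearMap.comp_apply]
        rw [add_right_comm, cap_hook_add_two _ _ (by omega), ih _ _ (by omega) i hi,
          cup_hook_of_le _ _ (by omega)]

/-- Each cap of the rainbow bends two nested arcs into one arc at the left ends, and the matching
cup supplies one at the right ends. The `2 * k` outer arcs survive as `k` on either side. -/
theorem rainbow_nest (k j : ℕ) :
    rainbow j (k + j) _ (nest (2 * (k + j))) =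
      castWeb (by omega) (arches (k + 2 * j + 2 * k) j (arches k j (nest (2 * k)))) := by
  induction j with
  | zero => rfl
  | succ j ih =>
    have e1 : rainbow (j + 1) (k + (j + 1)) _ (nest (2 * (k + (j + 1)))) =
        cup (m := 0 + 2 * (2 * (k + j)) + 2) (k + j)
          (rainbow j (k + j) _ (cap (m := 0 + 2 * (2 * (k + j) + 1)) (k + j)
            (nest (2 * (k + j) + 2)))) := rfl
    rw [e1, cap_nest _ _ (by omega), rainbow_cup _ _ _ (by omega), ih, cup_castWeb,
      show 2 * (2 * (k + j)) - (k + j) = k + 2 * j + 2 * k + j by omega, cup_castWeb]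
    have e2 := cup_arches (k + j) (k + 2 * j + 2 * k) (j + 1) (by omega)
      (arches k j (nest (2 * k)))
    have e3 := arches_succ (k + 2 * j + 2 * k) j (arches k j (nest (2 * k)))
    rw [e3] at e2
    rw [e2, castWeb_castWeb, show k + 2 * j + 2 * k + 2 = k + 2 * (j + 1) + 2 * k by ring]
    rfl

end Arcs

/-! ### The full twist formula -/

theorem bracket_slide {m : ℕ} (p : ℕ) (D : TangleDiagram m) (b : ℕ) (hb : p + b < m) :
    bracket (D.slide p b hb) = slideR p b (bracket D) := by
  induction b with
  | zero => rfl
  | succ b ih =>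
    rw [slideR, Module.End.mul_apply, ← ih (by omega), crossing_apply,
      hook_eq_turnback _ (by omega)]
    rfl

theorem bracket_cableCross {m : ℕ} (p b a : ℕ) (h : p + a + b ≤ m) (D : TangleDiagram m) :
    bracket (D.cableCross p b a h) = bandCrossing p b a (bracket D) := by
  induction a generalizing D with
  | zero => rfl
  | succ a ih => rw [TangleDiagram.cableCross, ih, bracket_slide]; rfl

theorem bracket_fullTwist (n : ℕ) :
    bracket (TangleDiagram.fullTwist n) = twist 0 n n (castWeb (by omega) (nest (2 * n))) := by
  rw [TangleDiagram.fullTwist, bracket_cableCross, bracket_cableCross, bracket_cast, bracket_arcs,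
    ← bandCrossing_mul_bandCrossing]
  rfl

theorem bracket_through (k j : ℕ) (n : ℕ) (hn : n = k + j) (hk : k ≤ n) :
    bracket (TangleDiagram.through n k hk) =
      rainbow j n (4 * n) (castWeb (by omega) (nest (2 * n))) := by
  subst hn
  rw [rainbow_castWeb, rainbow_nest, castWeb_castWeb, TangleDiagram.through, bracket_cast,
    bracket_arcs, bracket_arcs, bracket_arcs]
  -- The difference `k + j - k` occurs in the types, hence the detour through a variable.
  have e : ∀ (d : ℕ) (hd : d = j) (h : 0 + 2 * (2 * k) + 2 * d + 2 * d = 4 * (k + j)),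
      castWeb h (arches (k + 2 * d + 2 * k) d (arches k d (nest (2 * k)))) =
        castWeb (by omega) (arches (k + 2 * j + 2 * k) j (arches k j (nest (2 * k)))) := by
    rintro d rfl h; rfl
  exact e _ (Nat.add_sub_cancel_left k j) _

theorem descPoch_mul_qPoch (k j : ℕ) : descPoch (k + j) j * qPoch k = qPoch (k + j) := by
  induction j with
  | zero => simp [descPoch]
  | succ j ih =>
    rw [← add_assoc, descPoch_succ_succ, mul_assoc, ih, qPoch_succ, mul_comm, q, ← pow_mul]
    norm_cast

theorem rainbowCoeff_self (n k : ℕ) (hk : k ≤ n) :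
    rainbowCoeff n n (n - k) =
      (-1) ^ (n - k) * q4 ^ (2 * (2 * (k : ℤ) ^ 2 - (n : ℤ) ^ 2 + (k : ℤ) - (n : ℤ))) *
        (qPoch n / qPoch k) * qBinom n k := by
  obtain ⟨j, rfl⟩ := Nat.exists_eq_add_of_le hk
  have h1 := qPoch_ne_zero k
  have h2 : descPoch (k + j) j = qPoch (k + j) / qPoch k :=
    eq_div_of_mul_eq h1 (descPoch_mul_qPoch k j)
  rw [Nat.add_sub_cancel_left, rainbowCoeff, h2, qBinom, if_pos hk, Nat.add_sub_cancel_left]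
  have e : 2 * ((k + j : ℕ) : ℤ) * (k + j : ℕ) - 4 * ((k + j : ℕ) + (k + j : ℕ)) * j + 4 * j ^ 2 -
      2 * j = 2 * (2 * (k : ℤ) ^ 2 - ((k + j : ℕ) : ℤ) ^ 2 + (k : ℤ) - ((k + j : ℕ) : ℤ)) := by
    push_cast; ring
  rw [e, mul_div_assoc, mul_assoc _ (_ / _) (_ / _), mul_assoc _ (_ / _) (_ / _), div_div]

/-- Nested arcs between four clasps are killed by turnbacks. -/
theorem killed_clasp_clasp_nest (n : ℕ) (p : ℕ) (hp : p = 0 ∨ p = n) :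
    Killed (clasp (2 * n) n (by omega) (clasp (3 * n) n (by omega)
      (castWeb (m' := 4 * n) (by omega) (nest (2 * n))))) p n := by
  intro i hi
  obtain ⟨N, hN⟩ := Nat.exists_eq_add_of_le' (show 2 ≤ 2 * n by omega)
  have h1 := Intertwines.clasp_far (m := 4 * n) (p := p) (N := n) (q := 2 * n) (n := n) (by omega)
    (by omega)
  have h2 := Intertwines.clasp_far (m := 4 * n) (p := p) (N := n) (q := 3 * n) (n := n) (by omega)
    (by omega)
  rw [← h1 i hi, ← h2 i hi, hook_castWeb]
  -- The turnback at `p + i` leaves an arc at `4n - 2 - (p + i)`. This lies within the clasp at `3n`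
  -- if `p = 0` and within the clasp at `2n` if `p = n`.
  have e : ∀ (M : ℕ) (hM : M = N + 2) (h : 0 + 2 * M = 4 * n), castWeb h (hook (p + i) (nest M)) =
      castWeb (show 4 * n - 2 + 2 = 4 * n by omega) (cup (2 * N - (p + i) + 2)
        (castWeb (m' := 4 * n - 2) (by omega) (cup (m := 0 + 2 * N) (p + i) (nest N)))) := by
    rintro M rfl h
    rw [hook_nest _ _ (by omega), cup_castWeb, castWeb_castWeb]
  have hC := (clasp_kills (m := 4 * n) (3 * n) n (by omega)).of_comp
    (clasp (m := 4 * n) (2 * n) n (by omega))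
  have hB := (clasp_kills (m := 4 * n) (2 * n) n (by omega)).comp
    (Intertwines.clasp_far (m := 4 * n) (p := 2 * n) (N := n) (q := 3 * n) (n := n) (by omega)
      (by omega))
  rw [e _ hN]
  rcases hp with rfl | rfl
  · rw [show 2 * N - (0 + i) + 2 = 3 * n + (n - 2 - i) by omega]
    exact hC.castWeb_cup _ (by omega) _ (by omega) _
  · rw [show 2 * N - (p + i) + 2 = 2 * p + (p - 2 - i) by omega]
    exact hB.castWeb_cup _ (by omega) _ (by omega) _

/-- The full twist of two bands of `n` clasped strands. -/
theorem clasped_fullTwist (n : ℕ) :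
    clasped n (bracket (TangleDiagram.fullTwist n)) =
      ∑ j ∈ Finset.range (n + 1), rainbowCoeff n n j •
        clasped n (rainbow j n (4 * n) (castWeb (by omega) (nest (2 * n)))) := by
  set v : WebSpace (4 * n) := castWeb (by omega) (nest (2 * n))
  have h0 : 0 + n ≤ 4 * n := by omega
  have h1 : n + n ≤ 4 * n := by omega
  have h2 : 2 * n + n ≤ 4 * n := by omega
  have h3 : 3 * n + n ≤ 4 * n := by omega
  have hA : Kills (clasp 0 n h0 ∘ₗ clasp n n h1) 0 n :=
    (clasp_kills 0 n h0).comp (Intertwines.clasp_far h1 (by omega))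
  have hB : Kills (clasp 0 n h0 ∘ₗ clasp n n h1) n n := (clasp_kills n n h1).of_comp _
  have c2 := Intertwines.clasp_far (p := 0) (N := 2 * n) h2 (by omega)
  have c3 := Intertwines.clasp_far (p := 0) (N := 2 * n) h3 (by omega)
  have ht := twist_expansion n n (p := 0) (clasp (2 * n) n h2 (clasp (3 * n) n h3 v))
    (clasp 0 n h0 ∘ₗ clasp n n h1) (by omega) (killed_clasp_clasp_nest n 0 (Or.inl rfl))
    (by rw [zero_add]; exact killed_clasp_clasp_nest n n (Or.inr rfl)) hA (by rwa [zero_add])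
  -- The left clasps touch none of the twisted strands and are moved outside, which reassembles
  -- `clasped`; the same is done for each rainbow below.
  rw [← c2.twist_apply (by omega), ← c3.twist_apply (by omega), ← bracket_fullTwist] at ht
  refine Eq.trans ht (Finset.sum_congr rfl fun j hj => ?_)
  have hj' := Finset.mem_range.1 hj
  rw [zero_add, (Intertwines.rainbow j n (2 * n) n (by omega)).clasp_apply h2 h2,
    (Intertwines.rainbow j n (3 * n) n (by omega)).clasp_apply h3 h3]
  rfl

end A1Web

end

theorem mainTheorem9 (n : ℕ) :
    A1Web.clasped n (A1Web.bracket (A1Web.TangleDiagram.fullTwist n)) =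
      ∑ k : Fin (n + 1),
        ((-1) ^ (n - k.val) *
            A1Web.q4 ^ (2 * (2 * (k.val : ℤ) ^ 2 - (n : ℤ) ^ 2 + (k.val : ℤ) - (n : ℤ))) *
            (A1Web.qPoch n / A1Web.qPoch k.val) * A1Web.qBinom n k.val) •
          A1Web.clasped n
            (A1Web.bracket (A1Web.TangleDiagram.through n k.val (Nat.le_of_lt_succ k.isLt))) := by
  -- The number `j` of turned-back pairs is `n - k`, so the sum is read backwards.
  rw [A1Web.clasped_fullTwist, ← Finset.sum_range_reflect, Finset.sum_range]
  refine Finset.sum_congr rfl fun k _ => ?_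
  have hk := Nat.le_of_lt_succ k.isLt
  rw [show n + 1 - 1 - k.val = n - k.val by omega, A1Web.rainbowCoeff_self n k hk,
    A1Web.bracket_through k.val (n - k.val) n (by omega) hk]
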